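/- Let $n\ge 1$, $r\in\mathbb R$, and let $p,q\in[1,+\infty]$ satisfy $\frac1p+\frac1q=1$ (with $1/\infty=0$). **Spaces.** For a continuous weight $\omega:\mathbb R^n\to\,]0,+\infty[$, let $\mathcal FL^p_\omega(\mathbb R^n)$ be the space of all $f\in\mathcal S'(\mathbb R^n)$ whose Fourier transform ($\widehat f(\xi)=\int e^{-i\xi\cdot x}f(x)\,dx$, extended to $\mathcal S'$) is a function with $\omega\widehat f\in L^p(\mathbb R^n)$, normed by $\|f\|_{\mathcal FL^p_\omega}=\|\omega\widehat f\|_{L^p}$. For $\Omega\subseteq\mathbb R^n$ open, let $\mathcal FL^p_{\omega,\mathrm{loc}}(\Omega)$ be the space of all $f\in\mathcal D'(\Omega)$ with $\varphi f\in\mathcal FL^p_\omega(\mathbb R^n)$ for every $\varphi\in C_0^\infty(\Omega)$, with the topology of the seminorms $f\mapsto\|\varphi f\|_{\mathcal FL^p_\omega}$. We say that such a space *is an algebra* (for the pointwise product) if its elements are continuous functions (on $\mathbb R^n$, resp. on $\Omega$), the pointwise product of two elements is again an element, and the product is continuous: there is $C$ with $\|fg\|_{\mathcal FL^p_\omega}\le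 C\|f\|_{\mathcal FL^p_\omega}\|g\|_{\mathcal FL^p_\omega}$ for all $f,g$; resp. for every $\varphi\in C_0^\infty(\Omega)$ there are $\varphi_1,\varphi_2\in C_0^\infty(\Omega)$ and $C$ with $\|\varphi fg\|_{\mathcal FL^p_\omega}\le C\|\varphi_1f\|_{\mathcal FL^p_\omega}\|\varphi_2g\|_{\mathcal FL^p_\omega}$ for all $f,g$. **Weights.** (a) $\langle\xi\rangle=(1+|\xi|^2)^{1/2}$. (b) For $M=(m_1,\dots,m_n)$ with positive integers $m_j$: $\langle\xi\rangle_M=\big(1+\sum_{j}\xi_j^{2m_j}\big)^{1/2}$ and $m_*=\min_jm_j$. (c) A *complete polyhedron* $\mathcal P\subset\mathbb R^n$ is the convex hull of a finite set $V(\mathcal P)\subset\mathbb Z_{\ge0}^n$ of convexly independent points (its vertices) with $0\in V(\mathcal P)\ne\{0\}$, such that $\mathcal P=\{x:\ x_j\ge0\ (1\le j\le n),\ \nu\cdot x\le1\ \ \forall\nu\in\mathcal N_1(\mathcal P)\}$ for a finite set $\mathcal N_1(\mathcal P)\subset\mathbb R^n$ of vectors with strictly positive components, none of which can be omitted. Put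 $\lambda_{\mathcal P}(\xi)=\big(\sum_{\alpha\in V(\mathcal P)}\xi^{2\alpha}\big)^{1/2}$, $\mu_0=\min\{|\gamma|=\gamma_1+\dots+\gamma_n:\gamma\in V(\mathcal P)\setminus\{0\}\}$, and $$\delta=\max\{\nu\cdot\beta:\ \nu\in\mathcal N_1(\mathcal P),\ \beta\in\mathcal P\cap\mathbb Z_{\ge0}^n,\ \nu'\cdot\beta\ne1\ \ \forall\nu'\in\mathcal N_1(\mathcal P)\},$$ so that $0\le\delta<1$. **Statement.** i. If $r>\frac nq$, then $\mathcal FL^p_r(\mathbb R^n):=\mathcal FL^p_{\langle\cdot\rangle^r}(\mathbb R^n)$ is an algebra. ii. For every $M$ as in (b), if $r>\frac n{m_*q}$, then $\mathcal FL^p_{r,M}(\mathbb R^n):=\mathcal FL^p_{\langle\cdot\rangle_M^r}(\mathbb R^n)$ is an algebra. iii. For every complete polyhedron $\mathcal P$, if $r>\frac n{(1-\delta)\mu_0q}$, then $\mathcal FL^p_{r,\mathcal P}(\mathbb R^n):=\mathcal FL^p_{\lambda_{\mathcal P}^r}(\mathbb R^n)$ is an algebra. Moreover, under the respective condition on $r$,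 for every open $\Omega\subseteq\mathbb R^n$ the local spaces $\mathcal FL^p_{\omega,\mathrm{loc}}(\Omega)$ with $\omega=\langle\cdot\rangle^r$, $\langle\cdot\rangle_M^r$, $\lambda_{\mathcal P}^r$ are algebras. -/

import Mathlib

open MeasureTheory TopologicalSpace
open scoped SchwartzMap Distributions ENNReal NNReal FourierTransform

noncomputable section

namespace FourierLebesgue

/-- The Euclidean space `ℝⁿ`. -/
abbrev Euc (n : ℕ) : Type := EuclideanSpace ℝ (Fin n)

/-! ### The Fourier transform, normalised as `∫ e^{-i ξ·x} f(x) dx` -/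

/-- The dilation `ξ ↦ (2π)⁻¹ ξ`. -/
def dilation (n : ℕ) : Euc n ≃L[ℝ] Euc n :=
  ContinuousLinearEquiv.smulLeft (Units.mk0 ((2 * Real.pi)⁻¹ : ℝ) (by positivity))

/-- The Fourier transform `φ ↦ ∫ e^{-i ξ·x} φ(x) dx` on the Schwartz space: Mathlib's transform
(with kernel `e^{-2π i ξ·x}`) followed by a dilation; see `schwartzFourier_apply`. -/
def schwartzFourier (n : ℕ) : 𝓢(Euc n, ℂ) →L[ℂ] 𝓢(Euc n, ℂ) :=
  (SchwartzMap.compCLMOfContinuousLinearEquiv ℂ (dilation n)).comp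
    (FourierTransform.fourierCLM ℂ 𝓢(Euc n, ℂ))

theorem schwartzFourier_apply {n : ℕ} (φ : 𝓢(Euc n, ℂ)) (ξ : Euc n) :
    schwartzFourier n φ ξ = ∫ x, Complex.exp (-Complex.I * (inner ℝ ξ x : ℝ)) * φ x := by
  have h : schwartzFourier n φ ξ = 𝓕 (φ : Euc n → ℂ) ((2 * Real.pi)⁻¹ • ξ) := rfl
  rw [h, Real.fourier_eq']
  refine integral_congr_ae (Filter.Eventually.of_forall fun x => ?_)
  have hpi : (Real.pi : ℂ) ≠ 0 := by exact_mod_cast Real.pi_ne_zero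
  simp only [inner_smul_right, smul_eq_mul, real_inner_comm ξ x]
  congr 2
  push_cast
  field_simp

/-- The Fourier transform of a tempered distribution, `⟨f̂, φ⟩ = ⟨f, φ̂⟩`. -/
def fourierDist {n : ℕ} (f : 𝓢'(Euc n, ℂ)) : 𝓢'(Euc n, ℂ) :=
  PointwiseConvergenceCLM.precomp ℂ (schwartzFourier n) f

theorem fourierDist_apply {n : ℕ} (f : 𝓢'(Euc n, ℂ)) (φ : 𝓢(Euc n, ℂ)) :
    fourierDist f φ = f (schwartzFourier n φ) := rfl

/-- The tempered distribution `T` is (given by integration against) the function `u`. -/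
def IsFunction {n : ℕ} (T : 𝓢'(Euc n, ℂ)) (u : Euc n → ℂ) : Prop :=
  ∀ φ : 𝓢(Euc n, ℂ), Integrable (fun x => φ x * u x) ∧ T φ = ∫ x, φ x * u x

theorem IsFunction.add {n : ℕ} {S T : 𝓢'(Euc n, ℂ)} {u v : Euc n → ℂ}
    (hS : IsFunction S u) (hT : IsFunction T v) : IsFunction (S + T) (u + v) := by
  intro φ
  have he : (fun x => φ x * (u + v) x) = fun x => φ x * u x + φ x * v x := by
    funext x; simp [mul_add]
  rw [he]
  refine ⟨(hS φ).1.add (hT φ).1, ?_⟩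
  rw [integral_add (hS φ).1 (hT φ).1, ← (hS φ).2, ← (hT φ).2]
  rfl

theorem IsFunction.smul {n : ℕ} {T : 𝓢'(Euc n, ℂ)} {u : Euc n → ℂ} (c : ℂ)
    (hT : IsFunction T u) : IsFunction (c • T) (c • u) := by
  intro φ
  have he : (fun x => φ x * (c • u) x) = fun x => c * (φ x * u x) := by
    funext x; simp [mul_left_comm]
  rw [he]
  refine ⟨(hT φ).1.const_mul c, ?_⟩
  rw [integral_const_mul, ← (hT φ).2]
  rfl

theorem IsFunction.zero {n : ℕ} : IsFunction (0 : 𝓢'(Euc n, ℂ)) 0 := by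
  intro φ
  refine ⟨by simp, ?_⟩
  simp only [Pi.zero_apply, mul_zero, integral_zero]
  rfl

/-! ### Weighted Fourier--Lebesgue spaces -/

/-- The space `FL^p_ω(ℝⁿ)` of tempered distributions `f` whose Fourier transform is a function
`u` with `ω u ∈ L^p`. -/
def FL {n : ℕ} (p : ℝ≥0∞) (ω : Euc n → ℝ) : Submodule ℂ 𝓢'(Euc n, ℂ) where
  carrier := {f | ∃ u : Euc n → ℂ, IsFunction (fourierDist f) u ∧
    MemLp (fun ξ => (ω ξ : ℂ) * u ξ) p volume}
  zero_mem' := by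
    refine ⟨0, ?_, by simp⟩
    rw [fourierDist, map_zero]
    exact IsFunction.zero
  add_mem' := by
    rintro f g ⟨u, hu, hu'⟩ ⟨v, hv, hv'⟩
    refine ⟨u + v, ?_, ?_⟩
    · rw [fourierDist, map_add]
      exact hu.add hv
    · have h : (fun ξ => (ω ξ : ℂ) * (u + v) ξ) =
          (fun ξ => (ω ξ : ℂ) * u ξ) + fun ξ => (ω ξ : ℂ) * v ξ := by
        funext ξ; exact mul_add _ _ _
      rw [h]
      exact hu'.add hv'
  smul_mem' := by
    rintro c f ⟨u, hu, hu'⟩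
    refine ⟨c • u, ?_, ?_⟩
    · rw [fourierDist, map_smul]
      exact hu.smul c
    · have h : (fun ξ => (ω ξ : ℂ) * (c • u) ξ) = fun ξ => c * ((ω ξ : ℂ) * u ξ) := by
        funext ξ; exact mul_left_comm _ _ _
      rw [h]
      exact hu'.const_mul c

/-- The norm `‖f‖_{FL^p_ω} = ‖ω f̂‖_{L^p}`. The function `u` representing `f̂` is unique up to null
sets, so that the infimum runs over a single value (and is `∞` if `f̂` is not a function). -/
def flNorm {n : ℕ} (p : ℝ≥0∞) (ω : Euc n → ℝ) (f : 𝓢'(Euc n, ℂ)) : ℝ≥0∞ :=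
  ⨅ (u : Euc n → ℂ) (_ : IsFunction (fourierDist f) u),
    eLpNorm (fun ξ => (ω ξ : ℂ) * u ξ) p volume

/-- `f` is the continuous function `F`. -/
def IsContFunction {n : ℕ} (f : 𝓢'(Euc n, ℂ)) (F : Euc n → ℂ) : Prop :=
  Continuous F ∧ IsFunction f F

/-- `FL^p_ω(ℝⁿ)` is an algebra for the pointwise product: its elements are continuous functions,
the pointwise product of two elements is again an element, and this product is continuous,
`‖f g‖ ≤ C ‖f‖ ‖g‖`. -/
structure IsAlgebra {n : ℕ} (p : ℝ≥0∞) (ω : Euc n → ℝ) : Prop where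
  exists_function : ∀ f ∈ FL p ω, ∃ F, IsContFunction f F
  exists_mul : ∀ f ∈ FL p ω, ∀ g ∈ FL p ω, ∀ F G, IsContFunction f F → IsContFunction g G →
    ∃ h ∈ FL p ω, IsContFunction h (fun x => F x * G x)
  norm_mul_le : ∃ C : ℝ≥0, ∀ f ∈ FL p ω, ∀ g ∈ FL p ω, ∀ h ∈ FL p ω, ∀ F G,
    IsContFunction f F → IsContFunction g G → IsContFunction h (fun x => F x * G x) →
      flNorm p ω h ≤ C * flNorm p ω f * flNorm p ω g

/-! ### Local spaces -/

/-- The space `𝓓'(Ω)` of complex distributions: continuous `ℂ`-linear forms on `C_c^∞(Ω; ℂ)`. -/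
abbrev Distr {n : ℕ} (Ω : Opens (Euc n)) : Type := 𝓓(Ω, ℂ) →L[ℂ] ℂ

theorem testFunction_hasTemperateGrowth {n : ℕ} {Ω : Opens (Euc n)} (φ : 𝓓(Ω, ℂ)) :
    Function.HasTemperateGrowth (φ : Euc n → ℂ) :=
  (φ.hasCompactSupport.toSchwartzMap φ.contDiff).hasTemperateGrowth

/-- The product `φ ψ` of a test function and a Schwartz function, as a function supported
in `supp φ`. -/
def mulSupported {n : ℕ} {Ω : Opens (Euc n)} (φ : 𝓓(Ω, ℂ)) (ψ : 𝓢(Euc n, ℂ)) :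
    𝓓_{(⟨tsupport φ, φ.hasCompactSupport⟩ : Compacts (Euc n))}(Euc n, ℂ) :=
  ContDiffMapSupportedIn.of_support_subset (f := fun x => φ x * ψ x)
    (φ.contDiff.mul (ψ.smooth _))
    ((Function.support_mul_subset_left _ _).trans subset_closure)

/-- Multiplication by a test function, `ψ ↦ φ ψ`, from the Schwartz space to `C_c^∞(Ω)`. -/
def mulTest {n : ℕ} {Ω : Opens (Euc n)} (φ : 𝓓(Ω, ℂ)) : 𝓢(Euc n, ℂ) →L[ℂ] 𝓓(Ω, ℂ) where
  toFun ψ := TestFunction.ofSupportedIn φ.tsupport_subset (mulSupported φ ψ)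
  map_add' ψ₁ ψ₂ := by
    ext x
    exact mul_add (φ x) (ψ₁ x) (ψ₂ x)
  map_smul' c ψ := by
    ext x
    exact mul_left_comm (φ x) c (ψ x)
  cont := by
    refine (TestFunction.continuous_ofSupportedIn φ.tsupport_subset).comp ?_
    let L : 𝓢(Euc n, ℂ) →ₗ[ℂ]
        𝓓_{(⟨tsupport φ, φ.hasCompactSupport⟩ : Compacts (Euc n))}(Euc n, ℂ) :=
      { toFun := mulSupported φ
        map_add' := fun ψ₁ ψ₂ => by ext x; exact mul_add (φ x) (ψ₁ x) (ψ₂ x)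
        map_smul' := fun c ψ => by ext x; exact mul_left_comm (φ x) c (ψ x) }
    let A : 𝓢(Euc n, ℂ) →L[ℂ] 𝓢(Euc n, ℂ) := SchwartzMap.smulLeftCLM ℂ (φ : Euc n → ℂ)
    change Continuous L
    refine WithSeminorms.continuous_of_continuous_comp
      (ContDiffMapSupportedIn.withSeminorms ℂ (Euc n) ℂ _ _) L fun i => ?_
    let N : Seminorm ℂ 𝓢(Euc n, ℂ) := (SchwartzMap.seminorm ℂ 0 i).comp A.toLinearMap
    have hN : Continuous N :=
      ((schwartz_withSeminorms ℂ (Euc n) ℂ).continuous_seminorm (0, i)).comp A.continuous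
    refine Seminorm.continuous_of_le hN ?_
    intro ψ
    refine (ContDiffMapSupportedIn.seminorm_top_le_iff ℂ (apply_nonneg _ _) i _).2 fun x _ => ?_
    have hL : (L ψ : Euc n → ℂ) = (A ψ : Euc n → ℂ) := by
      rw [SchwartzMap.smulLeftCLM_apply (testFunction_hasTemperateGrowth φ)]
      rfl
    rw [hL]
    exact SchwartzMap.norm_iteratedFDeriv_le_seminorm ℂ (A ψ) i x

theorem mulTest_apply {n : ℕ} {Ω : Opens (Euc n)} (φ : 𝓓(Ω, ℂ)) (ψ : 𝓢(Euc n, ℂ)) (x : Euc n) :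
    mulTest φ ψ x = φ x * ψ x := rfl

/-- The tempered distribution `φ f`, for `f ∈ 𝓓'(Ω)` and `φ ∈ C_c^∞(Ω)`:
`⟨φ f, ψ⟩ = ⟨f, φ ψ⟩`. -/
def cutoff {n : ℕ} {Ω : Opens (Euc n)} (φ : 𝓓(Ω, ℂ)) (f : Distr Ω) : 𝓢'(Euc n, ℂ) :=
  ContinuousLinearMap.toPointwiseConvergenceCLM _ _ _ _ (f.comp (mulTest φ))

theorem cutoff_apply {n : ℕ} {Ω : Opens (Euc n)} (φ : 𝓓(Ω, ℂ)) (f : Distr Ω) (ψ : 𝓢(Euc n, ℂ)) :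
    cutoff φ f ψ = f (mulTest φ ψ) := rfl

/-- The local space `FL^p_{ω,loc}(Ω)`: distributions `f` on `Ω` with `φ f ∈ FL^p_ω(ℝⁿ)` for every
`φ ∈ C_c^∞(Ω)`. -/
def FLloc {n : ℕ} (p : ℝ≥0∞) (ω : Euc n → ℝ) (Ω : Opens (Euc n)) : Submodule ℂ (Distr Ω) where
  carrier := {f | ∀ φ : 𝓓(Ω, ℂ), cutoff φ f ∈ FL p ω}
  zero_mem' := fun _ => (FL p ω).zero_mem
  add_mem' := fun hf hg φ => (FL p ω).add_mem (hf φ) (hg φ)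
  smul_mem' := fun c _ hf φ => (FL p ω).smul_mem c (hf φ)

/-- The distribution `f` on `Ω` is the function `F`, continuous on `Ω` (the values of `F` outside
`Ω` are irrelevant). -/
def IsContFunctionOn {n : ℕ} {Ω : Opens (Euc n)} (f : Distr Ω) (F : Euc n → ℂ) : Prop :=
  ContinuousOn F Ω ∧ ∀ φ : 𝓓(Ω, ℂ), f φ = ∫ x, φ x * F x

/-- `FL^p_{ω,loc}(Ω)` is an algebra for the pointwise product: its elements are continuous
functions on `Ω`, the pointwise product of two elements is again an element, and this product is
continuous for the topology given by the seminorms `f ↦ ‖φ f‖_{FL^p_ω}`, `φ ∈ C_c^∞(Ω)`. -/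
structure IsLocAlgebra {n : ℕ} (p : ℝ≥0∞) (ω : Euc n → ℝ) (Ω : Opens (Euc n)) : Prop where
  exists_function : ∀ f ∈ FLloc p ω Ω, ∃ F, IsContFunctionOn f F
  exists_mul : ∀ f ∈ FLloc p ω Ω, ∀ g ∈ FLloc p ω Ω, ∀ F G,
    IsContFunctionOn f F → IsContFunctionOn g G →
      ∃ h ∈ FLloc p ω Ω, IsContFunctionOn h (fun x => F x * G x)
  seminorm_mul_le : ∀ φ : 𝓓(Ω, ℂ), ∃ φ₁ φ₂ : 𝓓(Ω, ℂ), ∃ C : ℝ≥0,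
    ∀ f ∈ FLloc p ω Ω, ∀ g ∈ FLloc p ω Ω, ∀ h ∈ FLloc p ω Ω, ∀ F G,
      IsContFunctionOn f F → IsContFunctionOn g G → IsContFunctionOn h (fun x => F x * G x) →
        flNorm p ω (cutoff φ h) ≤ C * flNorm p ω (cutoff φ₁ f) * flNorm p ω (cutoff φ₂ g)

/-! ### The weights -/

/-- The homogeneous weight `⟨ξ⟩ = (1 + |ξ|²)^{1/2}`. -/
def homWeight {n : ℕ} (ξ : Euc n) : ℝ := Real.sqrt (1 + ‖ξ‖ ^ 2)

/-- The quasi-homogeneous weight `⟨ξ⟩_M = (1 + ∑ ξ_j^{2 m_j})^{1/2}`. -/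
def quasiHomWeight {n : ℕ} (M : Fin n → ℕ) (ξ : Euc n) : ℝ :=
  Real.sqrt (1 + ∑ j, ξ j ^ (2 * M j))

/-- A lattice point `α ∈ ℕⁿ` as a point of `ℝⁿ`. -/
def latticePoint {n : ℕ} (α : Fin n → ℕ) : Fin n → ℝ := fun j => (α j : ℝ)

/-- A complete polyhedron `𝒫` in `ℝⁿ`. It is given by its vertices `V(𝒫)`, which are lattice points
with nonnegative coordinates, and it is described by the half-spaces `x_j ≥ 0` (that is, the unit
inner normals of the facets through the origin are `e_1, …, e_n`) and `ν · x ≤ 1` for `ν` in the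
finite set `N₁(𝒫)`, all of whose elements have strictly positive components. By the last field no
half-space in the description is superfluous, so that `N₁(𝒫)` is determined by `𝒫`. (The
half-spaces `x_j ≥ 0` are never superfluous, since the components of the `ν` are positive.) -/
structure CompletePolyhedron (n : ℕ) where
  /-- the set `V(𝒫)` of vertices -/
  vertices : Finset (Fin n → ℕ)
  convexIndependent : ConvexIndependent ℝ (fun α : vertices => latticePoint (α : Fin n → ℕ))
  zero_mem : 0 ∈ vertices
  vertices_ne : vertices ≠ {0}
  /-- the set `N₁(𝒫)` of normals of the facets that do not contain the origin -/
  normals : Finset (Fin n → ℝ)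
  normals_pos : ∀ ν ∈ normals, ∀ j, 0 < ν j
  convexHull_eq : convexHull ℝ (latticePoint '' (vertices : Set (Fin n → ℕ))) =
    {x : Fin n → ℝ | (∀ j, 0 ≤ x j) ∧ ∀ ν ∈ normals, ν ⬝ᵥ x ≤ 1}
  normals_irredundant : ∀ ν ∈ normals, ∃ x : Fin n → ℝ,
    (∀ j, 0 ≤ x j) ∧ (∀ ν' ∈ normals, ν' ≠ ν → ν' ⬝ᵥ x ≤ 1) ∧ 1 < ν ⬝ᵥ x

namespace CompletePolyhedron

variable {n : ℕ} (P : CompletePolyhedron n)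

/-- The polyhedron `𝒫` as a set: the convex hull of its vertices. -/
def carrier : Set (Fin n → ℝ) := convexHull ℝ (latticePoint '' (P.vertices : Set (Fin n → ℕ)))

/-- The multi-quasi-elliptic weight `λ_𝒫(ξ) = (∑_{α ∈ V(𝒫)} ξ^{2α})^{1/2}`. -/
def weight (ξ : Euc n) : ℝ :=
  Real.sqrt (∑ α ∈ P.vertices, ∏ j, ξ j ^ (2 * α j))

/-- The minimum order `μ₀ = min {|γ| : γ ∈ V(𝒫), γ ≠ 0}`. -/
def minOrder : ℕ := sInf {k | ∃ γ ∈ P.vertices, γ ≠ 0 ∧ k = ∑ j, γ j}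

/-- `δ`, the maximum of `ν · β` over `ν ∈ N₁(𝒫)` and over the lattice points `β` of `𝒫` which lie
on none of the faces `{x ∈ 𝒫 : ν · x = 1}`, `ν ∈ N₁(𝒫)`. (This is a finite nonempty set of
numbers, since `β = 0` is allowed.) -/
def delta : ℝ := sSup {t | ∃ β : Fin n → ℕ, latticePoint β ∈ P.carrier ∧
  (∀ ν ∈ P.normals, ν ⬝ᵥ latticePoint β ≠ 1) ∧ ∃ ν ∈ P.normals, t = ν ⬝ᵥ latticePoint β}

end CompletePolyhedron

end FourierLebesgue

end

open MeasureTheory TopologicalSpace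
open scoped SchwartzMap Distributions ENNReal NNReal FourierTransform

/-! ### Weighted convolution estimate -/

namespace FourierLebesgue

variable {n : ℕ}

/-! On the Fourier side the product is a convolution, so everything reduces to two properties of the
weight: `ω⁻¹ ∈ L^q`, and `ω(ξ+η) ≤ ω(ξ) ω(η) (κ(ξ) + κ(η))` with `κ ∈ L^q`. By Hölder, the first
makes transforms integrable, so elements are continuous functions and products transform to
convolutions. The second, with Hölder at each frequency and then Tonelli, bounds the weighted
convolution (`eLpNorm_weight_mul_convolution_le`, `isAlgebra_of_weight`).

Let `ω = L^r` with `L ≥ 1`, `|ξ_j|^m ≤ L` and `L(ξ+η) ≤ C (L(ξ) L(η)^δ + L(ξ)^δ L(η))`. Then `κ` is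
a multiple of `L^{-(1-δ)r}`, which is in `L^q` once `(1-δ) m r > n/q` (`isAlgebra_rpow`).
Quasi-homogeneous weights have `δ = 0`.

For a polyhedron, a vertex monomial at `ξ+η` is controlled by some `|ξ|^β |η|^γ` with `β + γ` the
vertex. If `β, γ ≠ 0`, positivity of the normals keeps both off the outer faces, so each factor is
at most `λ^δ` (`prod_abs_pow_le_weight_rpow_delta`). A vertex on each axis gives `m = μ₀`
(`exists_vertex_on_axis`).

The local case follows by cutoffs: `φfg = (φf)(χg)` if `χ = 1` on `supp φ`. -/

/-- The `L^p` norm over `ξ` of the `L^p` norm over `η` of `a(η) b(ξ - η)` is `‖a‖ ‖b‖`. -/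
theorem eLpNorm_eLpNorm_mul_sub_le {p : ℝ≥0∞} (hp : p ≠ 0) {a b : Euc n → ℝ}
    (ha : AEStronglyMeasurable a) (hb : AEStronglyMeasurable b) :
    eLpNorm (fun ξ => eLpNorm (fun η => a η * b (ξ - η)) p volume) p volume ≤
      eLpNorm a p volume * eLpNorm b p volume := by
  rcases eq_or_ne p ∞ with rfl | hp'
  · simp only [eLpNorm_exponent_top]
    refine eLpNormEssSup_le_of_ae_enorm_bound (Filter.Eventually.of_forall fun ξ => ?_)
    simp only [enorm_eq_self]
    refine eLpNormEssSup_le_of_ae_enorm_bound ?_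
    have hb' := (quasiMeasurePreserving_sub_left_of_right_invariant volume ξ).ae
      (ae_le_eLpNormEssSup (f := b) (μ := volume))
    filter_upwards [ae_le_eLpNormEssSup (f := a) (μ := volume), hb'] with η h1 h2
    rw [enorm_mul]
    exact mul_le_mul' h1 h2
  · have hp0 : 0 < p.toReal := ENNReal.toReal_pos hp hp'
    have hm : AEMeasurable (fun z : Euc n × Euc n => ‖a z.2 * b (z.1 - z.2)‖ₑ ^ p.toReal)
        (volume.prod volume) :=
      ((ha.convolution_integrand (ContinuousLinearMap.mul ℝ ℝ) hb).enorm).pow_const _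
    -- Tonelli and translation invariance factor the double integral.
    have key : ∫⁻ ξ, ∫⁻ η, ‖a η * b (ξ - η)‖ₑ ^ p.toReal =
        (∫⁻ η, ‖a η‖ₑ ^ p.toReal) * ∫⁻ η, ‖b η‖ₑ ^ p.toReal := by
      rw [lintegral_lintegral_swap hm, ← lintegral_mul_const'' _ (ha.enorm.pow_const _)]
      refine lintegral_congr fun η => ?_
      simp_rw [enorm_mul, ENNReal.mul_rpow_of_nonneg _ _ hp0.le]
      have hbm : AEMeasurable (fun ξ => ‖b (ξ - η)‖ₑ ^ p.toReal) volume :=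
        ((hb.comp_measurePreserving (measurePreserving_sub_right volume η)).enorm).pow_const _
      rw [lintegral_const_mul'' _ hbm,
        lintegral_sub_right_eq_self (fun ξ => ‖b ξ‖ₑ ^ p.toReal) η]
    simp only [eLpNorm_eq_lintegral_rpow_enorm_toReal hp hp', enorm_eq_self]
    rw [← ENNReal.mul_rpow_of_nonneg _ _ (by positivity), ← key]
    refine le_of_eq ?_
    congr 1
    refine lintegral_congr fun ξ => ?_
    rw [← ENNReal.rpow_mul, one_div, inv_mul_cancel₀ hp0.ne', ENNReal.rpow_one]

/-- The weighted Young-type inequality `‖ω (u ⋆ v)‖ ≤ 2 ‖κ‖ ‖ω u‖ ‖ω v‖`. -/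
theorem eLpNorm_weight_mul_convolution_le {p q : ℝ≥0∞} [hpq : q.HolderConjugate p]
    {ω κ : Euc n → ℝ} (hω : Continuous ω) (hω0 : ∀ ξ, 0 < ω ξ)
    (hωκ : ∀ ξ η, ω (ξ + η) ≤ ω ξ * ω η * (κ ξ + κ η)) (hκ : MemLp κ q)
    {u v : Euc n → ℂ} (hu : AEStronglyMeasurable u) (hv : AEStronglyMeasurable v) :
    eLpNorm (fun ξ => (ω ξ : ℂ) * convolution u v (ContinuousLinearMap.mul ℂ ℂ) volume ξ) p volume ≤
      2 * eLpNorm κ q volume * (eLpNorm (fun ξ => (ω ξ : ℂ) * u ξ) p volume *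
        eLpNorm (fun ξ => (ω ξ : ℂ) * v ξ) p volume) := by
  have hp : p ≠ 0 := (ENNReal.HolderConjugate.pos p q).ne'
  set a : Euc n → ℝ := fun ξ => ω ξ * ‖u ξ‖ with ha_def
  set b : Euc n → ℝ := fun ξ => ω ξ * ‖v ξ‖ with hb_def
  have ha : AEStronglyMeasurable a := hω.aestronglyMeasurable.mul hu.norm
  have hb : AEStronglyMeasurable b := hω.aestronglyMeasurable.mul hv.norm
  have hna : eLpNorm (fun ξ => (ω ξ : ℂ) * u ξ) p volume = eLpNorm a p volume :=
    eLpNorm_congr_norm_ae (Filter.Eventually.of_forall fun ξ => by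
      simp [a])
  have hnb : eLpNorm (fun ξ => (ω ξ : ℂ) * v ξ) p volume = eLpNorm b p volume :=
    eLpNorm_congr_norm_ae (Filter.Eventually.of_forall fun ξ => by
      simp [b])
  rw [hna, hnb]
  -- Split the weight along `ξ = η + (ξ - η)`, then apply Hölder for fixed `ξ`, with the `κ` terms
  -- in `L^q` and `a(η) b(ξ - η)` in `L^p`.
  have hpt : ∀ ξ, ‖(ω ξ : ℂ) * convolution u v (ContinuousLinearMap.mul ℂ ℂ) volume ξ‖ₑ ≤
      2 * eLpNorm κ q volume * eLpNorm (fun η => a η * b (ξ - η)) p volume := by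
    intro ξ
    have hmp : MeasurePreserving (fun η : Euc n => ξ - η) volume volume :=
      Measure.measurePreserving_sub_left volume ξ
    have hκ' : AEStronglyMeasurable (fun η => κ (ξ - η)) := hκ.1.comp_measurePreserving hmp
    have hb' : AEStronglyMeasurable (fun η => b (ξ - η)) := hb.comp_measurePreserving hmp
    have hK : eLpNorm (κ + fun η => κ (ξ - η)) q volume ≤ 2 * eLpNorm κ q volume := by
      refine (eLpNorm_add_le hκ.1 hκ' (ENNReal.HolderConjugate.one_le q p)).trans ?_
      rw [two_mul]
      gcongr
      exact (eLpNorm_comp_measurePreserving hκ.1 hmp).le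
    rw [convolution_def, enorm_mul]
    calc ‖(ω ξ : ℂ)‖ₑ * ‖∫ t, (ContinuousLinearMap.mul ℂ ℂ) (u t) (v (ξ - t))‖ₑ
        ≤ ‖(ω ξ : ℂ)‖ₑ * ∫⁻ t, ‖(ContinuousLinearMap.mul ℂ ℂ) (u t) (v (ξ - t))‖ₑ := by
          gcongr; exact enorm_integral_le_lintegral_enorm _
      _ = ∫⁻ t, ‖(ω ξ : ℂ)‖ₑ * ‖(ContinuousLinearMap.mul ℂ ℂ) (u t) (v (ξ - t))‖ₑ :=
          (lintegral_const_mul' _ _ enorm_ne_top).symm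
      _ ≤ ∫⁻ t, ‖((κ + fun η => κ (ξ - η)) • fun η => a η * b (ξ - η)) t‖ₑ := by
          refine lintegral_mono fun t => ?_
          rw [← enorm_mul, enorm_le_iff_norm_le]
          have h := hωκ t (ξ - t)
          rw [add_sub_cancel] at h
          simp only [ContinuousLinearMap.mul_apply', Pi.smul_apply', Pi.add_apply, smul_eq_mul,
            norm_mul, Complex.norm_real, a, b, Real.norm_eq_abs, abs_norm, abs_of_pos (hω0 _)]
          calc ω ξ * (‖u t‖ * ‖v (ξ - t)‖)
              -- No sign is assumed on `κ`, hence the absolute value.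
              ≤ (ω t * ω (ξ - t) * |κ t + κ (ξ - t)|) * (‖u t‖ * ‖v (ξ - t)‖) := by
                gcongr
                refine h.trans ?_
                gcongr
                · exact mul_nonneg (hω0 _).le (hω0 _).le
                · exact le_abs_self _
            _ = _ := by ring
      _ = eLpNorm ((κ + fun η => κ (ξ - η)) • fun η => a η * b (ξ - η)) 1 volume := by
          rw [eLpNorm_one_eq_lintegral_enorm]
      _ ≤ eLpNorm (κ + fun η => κ (ξ - η)) q volume *
            eLpNorm (fun η => a η * b (ξ - η)) p volume :=
          eLpNorm_smul_le_mul_eLpNorm (ha.mul hb') (hκ.1.add hκ')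
      _ ≤ _ := by gcongr
  have hc : (2 * eLpNorm κ q volume) ≠ ∞ := ENNReal.mul_ne_top (by simp) hκ.2.ne
  lift (2 * eLpNorm κ q volume) to ℝ≥0 using hc with c
  calc _ ≤ c * eLpNorm (fun ξ => eLpNorm (fun η => a η * b (ξ - η)) p volume) p volume :=
        eLpNorm_le_mul_eLpNorm_of_ae_le_mul'
          (Filter.Eventually.of_forall fun ξ => by simpa using hpt ξ) p
    _ ≤ _ := by
        gcongr
        exact eLpNorm_eLpNorm_mul_sub_le hp ha hb

end FourierLebesgue

namespace FourierLebesgue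

variable {n : ℕ}

/-! ### Test functions and uniqueness -/

theorem exists_testFunction_eq_one {Ω : Opens (Euc n)} {K : Set (Euc n)} (hK : IsCompact K)
    (hKΩ : K ⊆ Ω) : ∃ χ : 𝓓(Ω, ℂ), ∀ x ∈ K, χ x = 1 := by
  obtain ⟨L, hL, hKL, hLΩ⟩ := exists_compact_between hK Ω.isOpen hKΩ
  obtain ⟨f, hf1, hf0, -⟩ := exists_contMDiffMap_one_nhds_of_subset_interior
    (n := (⊤ : ℕ∞)) (modelWithCornersSelf ℝ (Euc n)) hK.isClosed hKL
  have hsupp : Function.support (fun x => (f x : ℂ)) ⊆ L := by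
    intro x hx
    by_contra h
    exact hx (by simp [hf0 x h])
  have hts : tsupport (fun x => (f x : ℂ)) ⊆ L := closure_minimal hsupp hL.isClosed
  refine ⟨⟨fun x => (f x : ℂ), ?_, ?_, hts.trans hLΩ⟩, fun x hx => ?_⟩
  · exact Complex.ofRealCLM.contDiff.comp f.contMDiff.contDiff
  · exact hL.of_isClosed_subset (isClosed_tsupport _) hts
  · have := hf1.self_of_nhdsSet x hx
    change (f x : ℂ) = 1
    rw [this, Complex.ofReal_one]

/-- A test function as a Schwartz function. -/
noncomputable def testToSchwartz {Ω : Opens (Euc n)} (φ : 𝓓(Ω, ℂ)) : 𝓢(Euc n, ℂ) :=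
  φ.hasCompactSupport.toSchwartzMap φ.contDiff

theorem testToSchwartz_apply {Ω : Opens (Euc n)} (φ : 𝓓(Ω, ℂ)) (x : Euc n) :
    testToSchwartz φ x = φ x := rfl

/-- A Schwartz function equal to `1` on a compact set turns integrability against test functions
into integrability on that set. -/
theorem IsFunction.locallyIntegrable {T : 𝓢'(Euc n, ℂ)} {u : Euc n → ℂ} (h : IsFunction T u) :
    LocallyIntegrable u := by
  refine locallyIntegrable_iff.2 fun K hK => ?_
  obtain ⟨χ, hχ⟩ := exists_testFunction_eq_one (Ω := ⊤) hK (Set.subset_univ _)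
  refine ((h (testToSchwartz χ)).1.integrableOn (s := K)).congr_fun (fun x hx => ?_)
    hK.measurableSet
  simp [testToSchwartz_apply, hχ x hx]

theorem IsFunction.ae_eq {T : 𝓢'(Euc n, ℂ)} {u v : Euc n → ℂ} (hu : IsFunction T u)
    (hv : IsFunction T v) : u =ᵐ[volume] v := by
  refine ae_eq_of_integral_contDiff_smul_eq hu.locallyIntegrable hv.locallyIntegrable
    fun g hg hgc => ?_
  have hg₁ : HasCompactSupport (Complex.ofRealCLM ∘ g) := hgc.comp_left rfl
  have hg₂ : ContDiff ℝ (⊤ : ℕ∞) (Complex.ofRealCLM ∘ g) := Complex.ofRealCLM.contDiff.comp hg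
  have h := (hu (hg₁.toSchwartzMap hg₂)).2.symm.trans (hv (hg₁.toSchwartzMap hg₂)).2
  simpa using h

theorem IsContFunction.eq_of_continuous {T : 𝓢'(Euc n, ℂ)} {F G : Euc n → ℂ} (hF : IsContFunction T F)
    (hG : IsContFunction T G) : F = G :=
  Continuous.ae_eq_iff_eq volume hF.1 hG.1 |>.1 (hF.2.ae_eq hG.2)

theorem IsFunction.ext {S T : 𝓢'(Euc n, ℂ)} {F : Euc n → ℂ} (hS : IsFunction S F)
    (hT : IsFunction T F) : S = T :=
  DFunLike.ext _ _ fun φ => (hS φ).2.trans (hT φ).2.symm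

theorem flNorm_eq {p : ℝ≥0∞} {ω : Euc n → ℝ} {f : 𝓢'(Euc n, ℂ)} {u : Euc n → ℂ}
    (hu : IsFunction (fourierDist f) u) :
    flNorm p ω f = eLpNorm (fun ξ => (ω ξ : ℂ) * u ξ) p volume := by
  refine le_antisymm (iInf₂_le u hu) (le_iInf₂ fun v hv => le_of_eq ?_)
  refine eLpNorm_congr_ae ?_
  filter_upwards [hu.ae_eq hv] with ξ h
  rw [h]

/-! ### Fourier synthesis of integrable functions -/

/-- The function `x ↦ (2π)⁻ⁿ ∫ e^{i ξ·x} u(ξ) dξ`. -/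
noncomputable def synthesis (u : Euc n → ℂ) : Euc n → ℂ :=
  𝓕⁻ (fun ζ => u ((2 * Real.pi) • ζ))

theorem integrable_comp_two_pi {u : Euc n → ℂ} (hu : Integrable u) :
    Integrable (fun ζ => u ((2 * Real.pi) • ζ)) :=
  hu.comp_smul (by positivity)

theorem continuous_neg_inner :
    Continuous fun z : Euc n × Euc n => (-innerₗ (Euc n)) z.1 z.2 :=
  (continuous_inner (𝕜 := ℝ) (E := Euc n)).neg

theorem continuous_synthesis {u : Euc n → ℂ} (hu : Integrable u) : Continuous (synthesis u) :=
  VectorFourier.fourierIntegral_continuous Real.continuous_fourierChar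
    continuous_neg_inner (integrable_comp_two_pi hu)

theorem norm_synthesis_le (u : Euc n → ℂ) (x : Euc n) :
    ‖synthesis u x‖ ≤ ∫ ζ, ‖u ((2 * Real.pi) • ζ)‖ :=
  VectorFourier.norm_fourierIntegral_le_integral_norm _ _ _ _ _

theorem integral_mul_fourierInv_eq {f g : Euc n → ℂ} (hf : Integrable f) (hg : Integrable g) :
    ∫ x, f x * 𝓕⁻ g x = ∫ x, 𝓕⁻ f x * g x := by
  have h := VectorFourier.integral_fourierIntegral_smul_eq_flip (f := f) (g := g)
    (L := -innerₗ (Euc n)) (μ := volume) (ν := volume) Real.continuous_fourierChar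
    continuous_neg_inner hf hg
  have h2 : (-innerₗ (Euc n)).flip = -innerₗ (Euc n) := by
    ext x y; simp [real_inner_comm]
  rw [h2] at h
  exact h.symm

theorem fourierInv_schwartzFourier (ψ : 𝓢(Euc n, ℂ)) (ζ : Euc n) :
    𝓕⁻ (schwartzFourier n ψ : Euc n → ℂ) ζ =
      (((2 * Real.pi) ^ n : ℝ) : ℂ) * ψ ((2 * Real.pi) • ζ) := by
  have hS : ∀ x, schwartzFourier n ψ x = 𝓕 (ψ : Euc n → ℂ) ((2 * Real.pi)⁻¹ • x) := fun _ => rfl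
  have hinv : 𝓕⁻ (𝓕 (ψ : Euc n → ℂ)) = ψ := by
    rw [← SchwartzMap.fourier_coe, ← SchwartzMap.fourierInv_coe, FourierTransform.fourierInv_fourier_eq]
  have hpi : (2 * Real.pi) ≠ 0 := by positivity
  -- The factor `(2π)^n` is the Jacobian of this substitution in Fourier inversion at `2πζ`.
  have key := Measure.integral_comp_smul (volume : Measure (Euc n))
    (fun y => Real.fourierChar (inner ℝ y ((2 * Real.pi) • ζ)) • 𝓕 (ψ : Euc n → ℂ) y)
    (2 * Real.pi)⁻¹
  rw [← Real.fourierInv_eq, hinv] at key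
  rw [Real.fourierInv_eq]
  have he : ∀ x : Euc n, inner ℝ ((2 * Real.pi)⁻¹ • x) ((2 * Real.pi) • ζ) = inner ℝ x ζ := by
    intro x
    rw [inner_smul_left, inner_smul_right]
    simp only [conj_trivial]
    field_simp
  simp only [he] at key
  simp only [hS, key]
  rw [finrank_euclideanSpace_fin, inv_pow, inv_inv, abs_of_pos (by positivity), Complex.real_smul]

/-- By duality, this identifies `u` as the transform of its synthesis; the Jacobian of `ζ ↦ 2πζ`
cancels the `(2π)^n` of `fourierInv_schwartzFourier`. -/
theorem integral_schwartzFourier_mul_synthesis {u : Euc n → ℂ} (hu : Integrable u)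
    (ψ : 𝓢(Euc n, ℂ)) :
    ∫ x, schwartzFourier n ψ x * synthesis u x = ∫ ξ, ψ ξ * u ξ := by
  rw [synthesis, integral_mul_fourierInv_eq (SchwartzMap.integrable _) (integrable_comp_two_pi hu)]
  simp only [fourierInv_schwartzFourier, mul_assoc]
  rw [integral_const_mul, Measure.integral_comp_smul volume (fun ξ => ψ ξ * u ξ),
    finrank_euclideanSpace_fin, abs_of_pos (by positivity), Complex.real_smul, ← mul_assoc,
    ← Complex.ofReal_mul, mul_inv_cancel₀ (by positivity), Complex.ofReal_one, one_mul]

/-- The inverse of `schwartzFourier`. -/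
noncomputable def schwartzFourierInv (n : ℕ) : 𝓢(Euc n, ℂ) →L[ℂ] 𝓢(Euc n, ℂ) :=
  (FourierTransform.fourierInvCLM ℂ 𝓢(Euc n, ℂ)).comp
    (SchwartzMap.compCLMOfContinuousLinearEquiv ℂ (dilation n).symm)

theorem schwartzFourier_schwartzFourierInv (φ : 𝓢(Euc n, ℂ)) :
    schwartzFourier n (schwartzFourierInv n φ) = φ := by
  ext x
  simp [schwartzFourier, schwartzFourierInv]

theorem schwartzFourierInv_schwartzFourier (φ : 𝓢(Euc n, ℂ)) :
    schwartzFourierInv n (schwartzFourier n φ) = φ := by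
  have : SchwartzMap.compCLMOfContinuousLinearEquiv ℂ (dilation n).symm (schwartzFourier n φ) =
      𝓕 φ := by
    ext x
    simp [schwartzFourier]
  simp [schwartzFourierInv, this]

theorem integrable_schwartz_mul_synthesis {u : Euc n → ℂ} (hu : Integrable u) (φ : 𝓢(Euc n, ℂ)) :
    Integrable (fun x => φ x * synthesis u x) :=
  φ.integrable.mul_bdd (c := ∫ ζ, ‖u ((2 * Real.pi) • ζ)‖)
    (continuous_synthesis hu).aestronglyMeasurable
    (Filter.Eventually.of_forall (norm_synthesis_le u))

theorem integrable_schwartz_mul {u : Euc n → ℂ} (hu : Integrable u) (φ : 𝓢(Euc n, ℂ)) :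
    Integrable (fun x => φ x * u x) :=
  hu.bdd_mul φ.continuous.aestronglyMeasurable
    (Filter.Eventually.of_forall fun x => φ.norm_le_seminorm ℂ x)

/-- Both directions are the pairing identity; the forward one also needs every Schwartz function to
be a transform. -/
theorem isFunction_fourierDist_iff {f : 𝓢'(Euc n, ℂ)} {u : Euc n → ℂ} (hu : Integrable u) :
    IsFunction (fourierDist f) u ↔ IsFunction f (synthesis u) := by
  constructor
  · intro h φ
    refine ⟨integrable_schwartz_mul_synthesis hu φ, ?_⟩
    rw [← schwartzFourier_schwartzFourierInv φ, integral_schwartzFourier_mul_synthesis hu,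
      ← fourierDist_apply, (h _).2]
  · intro h ψ
    refine ⟨integrable_schwartz_mul hu ψ, ?_⟩
    rw [fourierDist_apply, (h _).2, integral_schwartzFourier_mul_synthesis hu]

theorem exists_isFunction_fourierDist {u : Euc n → ℂ} (hu : Integrable u) :
    ∃ f : 𝓢'(Euc n, ℂ), IsFunction (fourierDist f) u := by
  let U := (memLp_one_iff_integrable.2 hu).toLp u
  refine ⟨PointwiseConvergenceCLM.precomp ℂ (schwartzFourierInv n)
    (Lp.toTemperedDistribution U), fun φ => ⟨integrable_schwartz_mul hu φ, ?_⟩⟩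
  change Lp.toTemperedDistribution U (schwartzFourierInv n (schwartzFourier n φ)) = _
  rw [schwartzFourierInv_schwartzFourier, Lp.toTemperedDistribution_apply]
  refine integral_congr_ae ?_
  filter_upwards [MemLp.coeFn_toLp (memLp_one_iff_integrable.2 hu)] with x hx
  simp [U, hx]

/-- The convolution `(2π)⁻ⁿ u ⋆ v`, the Fourier transform of `synthesis u * synthesis v`. -/
noncomputable def scaledConvolution (u v : Euc n → ℂ) : Euc n → ℂ :=
  ((((2 * Real.pi) ^ n)⁻¹ : ℝ) : ℂ) • convolution u v (ContinuousLinearMap.mul ℂ ℂ) volume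

theorem integrable_scaledConvolution {u v : Euc n → ℂ} (hu : Integrable u) (hv : Integrable v) :
    Integrable (scaledConvolution u v) :=
  (hu.integrable_convolution _ hv).smul _

theorem synthesis_scaledConvolution {u v : Euc n → ℂ} (hu : Integrable u) (hv : Integrable v)
    (x : Euc n) : synthesis (scaledConvolution u v) x = synthesis u x * synthesis v x := by
  simp only [synthesis, Real.fourierInv_eq_fourier_neg]
  rw [← Real.fourier_mul_convolution_eq (integrable_comp_two_pi hu) (integrable_comp_two_pi hv)]
  refine congrArg (fun f : Euc n → ℂ => (𝓕 f : Euc n → ℂ) (-x)) (funext fun ζ => ?_)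
  simp only [scaledConvolution, Pi.smul_apply, convolution_def, ContinuousLinearMap.mul_apply']
  -- Rescaling the convolution variable produces the `(2π)⁻ⁿ` of `scaledConvolution`.
  have h := Measure.integral_comp_smul (volume : Measure (Euc n))
    (fun t => u t * v ((2 * Real.pi) • ζ - t)) (2 * Real.pi)
  simp only [smul_sub]
  rw [h, finrank_euclideanSpace_fin, abs_of_pos (by positivity), Complex.real_smul, smul_eq_mul]

/-! ### The algebra property from the weight -/

section

variable {p q : ℝ≥0∞} [hpq : q.HolderConjugate p] {ω κ : Euc n → ℝ}

/-- Hölder applied to `u = ω⁻¹ · (ω u)`. -/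
theorem exists_integrable_of_mem_FL (hω0 : ∀ ξ, 0 < ω ξ) (hinv : MemLp (fun ξ => (ω ξ)⁻¹) q)
    {f : 𝓢'(Euc n, ℂ)} (hf : f ∈ FL p ω) :
    ∃ u, Integrable u ∧ IsFunction (fourierDist f) u ∧
      MemLp (fun ξ => (ω ξ : ℂ) * u ξ) p volume := by
  obtain ⟨u, hu, hup⟩ := hf
  refine ⟨u, ?_, hu, hup⟩
  have h : MemLp ((fun ξ => (ω ξ)⁻¹) • fun ξ => (ω ξ : ℂ) * u ξ) 1 volume := hup.smul hinv
  refine (memLp_one_iff_integrable.1 h).congr (Filter.Eventually.of_forall fun ξ => ?_)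
  have := (hω0 ξ).ne'
  simp [Complex.real_smul, this]

theorem isAlgebra_of_weight (hω : Continuous ω) (hω0 : ∀ ξ, 0 < ω ξ)
    (hωκ : ∀ ξ η, ω (ξ + η) ≤ ω ξ * ω η * (κ ξ + κ η)) (hκ : MemLp κ q)
    (hinv : MemLp (fun ξ => (ω ξ)⁻¹) q) : IsAlgebra p ω := by
  have hcont : ∀ {f : 𝓢'(Euc n, ℂ)} {u : Euc n → ℂ}, Integrable u → IsFunction (fourierDist f) u →
      IsContFunction f (synthesis u) := fun hu h =>
    ⟨continuous_synthesis hu, (isFunction_fourierDist_iff hu).1 h⟩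
  have hnorm : ∀ {u v : Euc n → ℂ}, Integrable u → Integrable v →
      eLpNorm (fun ξ => (ω ξ : ℂ) * scaledConvolution u v ξ) p volume ≤
        (‖(((2 * Real.pi) ^ n)⁻¹ : ℝ)‖ₑ * (2 * eLpNorm κ q volume)) *
          (eLpNorm (fun ξ => (ω ξ : ℂ) * u ξ) p volume *
            eLpNorm (fun ξ => (ω ξ : ℂ) * v ξ) p volume) := by
    intro u v hu hv
    have he : (fun ξ => (ω ξ : ℂ) * scaledConvolution u v ξ) =
        ((((2 * Real.pi) ^ n)⁻¹ : ℝ) : ℂ) • fun ξ => (ω ξ : ℂ) *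
          convolution u v (ContinuousLinearMap.mul ℂ ℂ) volume ξ := by
      ext ξ
      simp only [scaledConvolution, Pi.smul_apply, smul_eq_mul]
      ring
    rw [he, eLpNorm_const_smul, mul_assoc, ← ofReal_norm, Complex.norm_real, ofReal_norm]
    gcongr
    exact eLpNorm_weight_mul_convolution_le hω hω0 hωκ hκ hu.1 hv.1
  have hC : (‖(((2 * Real.pi) ^ n)⁻¹ : ℝ)‖ₑ * (2 * eLpNorm κ q volume)) ≠ ∞ :=
    ENNReal.mul_ne_top enorm_ne_top (ENNReal.mul_ne_top (by simp) hκ.2.ne)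
  have hprod : ∀ {f g : 𝓢'(Euc n, ℂ)} {F G u v : Euc n → ℂ}, IsContFunction f F → IsContFunction g G →
      Integrable u → Integrable v → IsFunction (fourierDist f) u → IsFunction (fourierDist g) v →
      (fun x => F x * G x) = synthesis (scaledConvolution u v) := by
    intro f g F G u v hF hG hu hv hfu hgv
    rw [hF.eq_of_continuous (hcont hu hfu), hG.eq_of_continuous (hcont hv hgv)]
    exact funext fun x => (synthesis_scaledConvolution hu hv x).symm
  refine ⟨fun f hf => ?_, fun f hf g hg F G hF hG => ?_, ?_⟩
  · obtain ⟨u, hu, hfu, -⟩ := exists_integrable_of_mem_FL hω0 hinv hf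
    exact ⟨_, hcont hu hfu⟩
  · obtain ⟨u, hu, hfu, hup⟩ := exists_integrable_of_mem_FL hω0 hinv hf
    obtain ⟨v, hv, hgv, hvp⟩ := exists_integrable_of_mem_FL hω0 hinv hg
    have hw := integrable_scaledConvolution hu hv
    obtain ⟨h, hh⟩ := exists_isFunction_fourierDist hw
    refine ⟨h, ⟨_, hh, ?_, ?_⟩, ?_⟩
    · exact (Complex.continuous_ofReal.comp hω).aestronglyMeasurable.mul hw.1
    · exact (hnorm hu hv).trans_lt
        (ENNReal.mul_lt_top hC.lt_top (ENNReal.mul_lt_top hup.2 hvp.2))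
    · rw [hprod hF hG hu hv hfu hgv]
      exact hcont hw hh
  · refine ⟨(‖(((2 * Real.pi) ^ n)⁻¹ : ℝ)‖ₑ * (2 * eLpNorm κ q volume)).toNNReal, ?_⟩
    intro f hf g hg h _ F G hF hG hFG
    obtain ⟨u, hu, hfu, hup⟩ := exists_integrable_of_mem_FL hω0 hinv hf
    obtain ⟨v, hv, hgv, hvp⟩ := exists_integrable_of_mem_FL hω0 hinv hg
    have hw := integrable_scaledConvolution hu hv
    rw [hprod hF hG hu hv hfu hgv] at hFG
    rw [flNorm_eq ((isFunction_fourierDist_iff hw).2 hFG.2), flNorm_eq hfu, flNorm_eq hgv,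
      ENNReal.coe_toNNReal hC, mul_assoc]
    exact hnorm hu hv

end

end FourierLebesgue

namespace FourierLebesgue

variable {n : ℕ}

/-! ### From the global to the local algebra property -/

section

variable {Ω : Opens (Euc n)}

theorem continuous_testFunction_mul (φ : 𝓓(Ω, ℂ)) {F : Euc n → ℂ} (hF : ContinuousOn F Ω) :
    Continuous fun x => φ x * F x := by
  refine continuous_iff_continuousAt.2 fun x => ?_
  by_cases hx : x ∈ tsupport φ
  · exact φ.continuous.continuousAt.mul
      (hF.continuousAt (Ω.isOpen.mem_nhds (φ.tsupport_subset hx)))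
  · have h : (fun y => φ y * F y) =ᶠ[nhds x] fun _ => 0 := by
      filter_upwards [(isClosed_tsupport φ).isOpen_compl.mem_nhds hx] with y hy
      rw [image_eq_zero_of_notMem_tsupport hy, zero_mul]
    exact continuousAt_const.congr h.symm

theorem isContFunction_cutoff {f : Distr Ω} {F : Euc n → ℂ} (hF : IsContFunctionOn f F)
    (φ : 𝓓(Ω, ℂ)) : IsContFunction (cutoff φ f) (fun x => φ x * F x) := by
  have hc := continuous_testFunction_mul φ hF.1
  refine ⟨hc, fun ψ => ⟨?_, ?_⟩⟩
  · refine (ψ.continuous.mul hc).integrable_of_hasCompactSupport ?_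
    exact (φ.hasCompactSupport.mul_right).mul_left
  · rw [cutoff_apply, hF.2]
    refine integral_congr_ae (Filter.Eventually.of_forall fun x => ?_)
    simp only [mulTest_apply]
    ring

theorem mulTest_testToSchwartz {χ φ : 𝓓(Ω, ℂ)} (h : ∀ x ∈ tsupport φ, χ x = 1) :
    mulTest χ (testToSchwartz φ) = φ := by
  ext x
  rw [mulTest_apply, testToSchwartz_apply]
  by_cases hx : x ∈ tsupport φ
  · rw [h x hx, one_mul]
  · rw [image_eq_zero_of_notMem_tsupport hx, mul_zero]

theorem testFunction_mul_eq {χ φ : 𝓓(Ω, ℂ)} (h : ∀ x ∈ tsupport φ, χ x = 1) (x : Euc n) :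
    φ x * χ x = φ x := by
  by_cases hx : x ∈ tsupport φ
  · rw [h x hx, mul_one]
  · rw [image_eq_zero_of_notMem_tsupport hx, zero_mul]

/-- Both sides are continuous and represent `φψf`, so they agree everywhere. This is the
compatibility needed for gluing. -/
theorem mul_eq_mul_of_cutoff {f : Distr Ω} {φ ψ : 𝓓(Ω, ℂ)} {F G : Euc n → ℂ}
    (hF : IsContFunction (cutoff φ f) F) (hG : IsContFunction (cutoff ψ f) G) (x : Euc n) :
    ψ x * F x = φ x * G x := by
  have hint : ∀ η : 𝓢(Euc n, ℂ), ∫ x, η x * (ψ x * F x) = ∫ x, η x * (φ x * G x) := by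
    intro η
    have h1 := (hF.2 (testToSchwartz (mulTest ψ η))).2
    have h2 := (hG.2 (testToSchwartz (mulTest φ η))).2
    rw [cutoff_apply] at h1 h2
    have he : mulTest φ (testToSchwartz (mulTest ψ η)) =
        mulTest ψ (testToSchwartz (mulTest φ η)) := by
      ext y
      simp only [mulTest_apply, testToSchwartz_apply]
      ring
    rw [he, h2] at h1
    simp only [testToSchwartz_apply, mulTest_apply] at h1
    calc _ = ∫ x, ψ x * η x * F x := by congr 1; ext x; ring
      _ = ∫ x, φ x * η x * G x := h1.symm
      _ = _ := by congr 1; ext x; ring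
  have hc1 : Continuous fun x => ψ x * F x := ψ.continuous.mul hF.1
  have hc2 : Continuous fun x => φ x * G x := φ.continuous.mul hG.1
  have hae : (fun x => ψ x * F x) =ᵐ[volume] fun x => φ x * G x := by
    refine ae_eq_of_integral_contDiff_smul_eq hc1.locallyIntegrable hc2.locallyIntegrable
      fun g hg hgc => ?_
    have hg₁ : HasCompactSupport (Complex.ofRealCLM ∘ g) := hgc.comp_left rfl
    have hg₂ : ContDiff ℝ (⊤ : ℕ∞) (Complex.ofRealCLM ∘ g) := Complex.ofRealCLM.contDiff.comp hg
    simpa using hint (hg₁.toSchwartzMap hg₂)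
  exact congrFun ((Continuous.ae_eq_iff_eq volume hc1 hc2).1 hae) x

/-- Near `x ∈ Ω` the function sought is the representative of `b_x f` divided by `b_x`, where `b_x`
is a test function with `b_x(x) = 1`; compatibility makes these quotients agree. -/
theorem exists_isContFunctionOn {f : Distr Ω}
    (h : ∀ φ : 𝓓(Ω, ℂ), ∃ F, IsContFunction (cutoff φ f) F) : ∃ F, IsContFunctionOn f F := by
  choose R hR using h
  have hbump : ∀ x : Euc n, ∃ φ : 𝓓(Ω, ℂ), x ∈ Ω → φ x = 1 := by
    intro x
    by_cases hx : x ∈ Ω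
    · obtain ⟨χ, hχ⟩ := exists_testFunction_eq_one (Ω := Ω) (isCompact_singleton (x := x))
        (Set.singleton_subset_iff.2 hx)
      exact ⟨χ, fun _ => hχ x rfl⟩
    · exact ⟨0, fun h => absurd h hx⟩
  choose b hb using hbump
  have hF : ∀ φ : 𝓓(Ω, ℂ), ∀ x ∈ Ω, R φ x = φ x * R (b x) x := by
    intro φ x hx
    have := mul_eq_mul_of_cutoff (hR φ) (hR (b x)) x
    rwa [hb x hx, one_mul] at this
  refine ⟨fun x => R (b x) x, fun x hx => ContinuousAt.continuousWithinAt ?_, fun φ => ?_⟩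
  · have hne : b x x ≠ 0 := by rw [hb x hx]; exact one_ne_zero
    have h1 : ContinuousAt (fun y => R (b x) y / b x y) x :=
      (hR (b x)).1.continuousAt.div (b x).continuous.continuousAt hne
    refine h1.congr ?_
    filter_upwards [Ω.isOpen.mem_nhds hx, (b x).continuous.continuousAt.eventually_ne hne]
      with y hy hy0
    rw [hF (b x) y hy, mul_div_cancel_left₀ _ hy0]
  -- With `χ = 1` on `supp φ`, `⟨f, φ⟩ = ⟨χf, φ⟩`, and `χf` has a known representative.
  · obtain ⟨χ, hχ⟩ := exists_testFunction_eq_one (Ω := Ω) φ.hasCompactSupport φ.tsupport_subset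
    have h1 := ((hR χ).2 (testToSchwartz φ)).2
    rw [cutoff_apply, mulTest_testToSchwartz hχ] at h1
    rw [h1]
    refine integral_congr_ae (Filter.Eventually.of_forall fun x => ?_)
    simp only [testToSchwartz_apply]
    by_cases hx : x ∈ Ω
    · rw [hF χ x hx, ← mul_assoc, testFunction_mul_eq hχ]
    · rw [image_eq_zero_of_notMem_tsupport fun h => hx (φ.tsupport_subset h), zero_mul, zero_mul]

theorem exists_distr_of_continuousOn {F : Euc n → ℂ} (hF : ContinuousOn F Ω) :
    ∃ h : Distr Ω, IsContFunctionOn h F := by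
  have hl : LocallyIntegrableOn F Ω := hF.locallyIntegrableOn Ω.isOpen.measurableSet
  refine ⟨TestFunction.integralAgainstBilinCLM (ContinuousLinearMap.mul ℂ ℂ) volume F, hF,
    fun φ => ?_⟩
  rw [TestFunction.integralAgainstBilinCLM_eq_integral hl]
  rfl

theorem IsAlgebra.isLocAlgebra {p : ℝ≥0∞} {ω : Euc n → ℝ} (hA : IsAlgebra p ω)
    (Ω : Opens (Euc n)) : IsLocAlgebra p ω Ω := by
  have hcut : ∀ {φ χ : 𝓓(Ω, ℂ)} {h : Distr Ω} {F G : Euc n → ℂ},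
      (∀ x ∈ tsupport φ, χ x = 1) → IsContFunctionOn h (fun x => F x * G x) →
      IsContFunction (cutoff φ h) (fun x => (φ x * F x) * (χ x * G x)) := by
    intro φ χ h F G hχ hh
    convert isContFunction_cutoff hh φ using 2 with x
    rw [mul_mul_mul_comm, testFunction_mul_eq hχ x]
  refine ⟨fun f hf => exists_isContFunctionOn fun φ => hA.exists_function _ (hf φ),
    fun f hf g hg F G hF hG => ?_, fun φ => ?_⟩
  · obtain ⟨h, hh⟩ := exists_distr_of_continuousOn (hF.1.mul hG.1)
    refine ⟨h, fun φ => ?_, hh⟩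
    obtain ⟨χ, hχ⟩ := exists_testFunction_eq_one (Ω := Ω) φ.hasCompactSupport φ.tsupport_subset
    obtain ⟨k, hk, hk'⟩ := hA.exists_mul _ (hf φ) _ (hg χ) _ _ (isContFunction_cutoff hF φ)
      (isContFunction_cutoff hG χ)
    rwa [(hcut hχ hh).2.ext hk'.2]
  · obtain ⟨χ, hχ⟩ := exists_testFunction_eq_one (Ω := Ω) φ.hasCompactSupport φ.tsupport_subset
    obtain ⟨C, hC⟩ := hA.norm_mul_le
    exact ⟨φ, χ, C, fun f hf g hg h hh F G hF hG hFG =>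
      hC _ (hf φ) _ (hg χ) _ (hh φ) _ _ (isContFunction_cutoff hF φ)
        (isContFunction_cutoff hG χ) (hcut hχ hFG)⟩

end

end FourierLebesgue

namespace FourierLebesgue

variable {n : ℕ}

/-! ### Powers of weights of polynomial growth -/

theorem memLp_rpow_one_add_norm {q : ℝ≥0∞} (hq : q ≠ 0) {s : ℝ} (hs : 0 ≤ s)
    (hns : (n : ℝ) * (q⁻¹).toReal < s) :
    MemLp (fun ξ : Euc n => (1 + ‖ξ‖) ^ (-s)) q := by
  have hpos : ∀ ξ : Euc n, 0 < 1 + ‖ξ‖ := fun ξ => by positivity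
  have hm : AEStronglyMeasurable (fun ξ : Euc n => (1 + ‖ξ‖) ^ (-s)) := by
    refine Continuous.aestronglyMeasurable ?_
    exact (continuous_const.add continuous_norm).rpow_const fun ξ => Or.inl (hpos ξ).ne'
  rcases eq_or_ne q ∞ with rfl | hq'
  · refine memLp_top_of_bound hm 1 (Filter.Eventually.of_forall fun ξ => ?_)
    rw [Real.norm_of_nonneg (Real.rpow_nonneg (hpos ξ).le _)]
    exact Real.rpow_le_one_of_one_le_of_nonpos (by linarith [norm_nonneg ξ]) (by linarith)
  · have hq0 : 0 < q.toReal := ENNReal.toReal_pos hq hq'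
    rw [ENNReal.toReal_inv, ← div_eq_mul_inv, div_lt_iff₀ hq0] at hns
    refine (integrable_norm_rpow_iff hm hq hq').1 ?_
    have := integrable_one_add_norm (μ := (volume : Measure (Euc n))) (r := s * q.toReal)
      (by rwa [finrank_euclideanSpace_fin])
    refine this.congr (Filter.Eventually.of_forall fun ξ => ?_)
    simp only
    rw [Real.norm_of_nonneg (Real.rpow_nonneg (hpos ξ).le _), ← Real.rpow_mul (hpos ξ).le, neg_mul]

theorem one_add_norm_le {m : ℕ} (hm : 0 < m) {ξ : Euc n} {L : ℝ} (hL : 1 ≤ L)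
    (h : ∀ j, |ξ j| ^ m ≤ L) : (1 + ‖ξ‖) ≤ (1 + n) * L ^ ((m : ℝ)⁻¹) := by
  have hm' : (m : ℝ) ≠ 0 := by exact_mod_cast hm.ne'
  have h1 : 1 ≤ L ^ ((m : ℝ)⁻¹) := Real.one_le_rpow hL (by positivity)
  have hj : ∀ j, |ξ j| ≤ L ^ ((m : ℝ)⁻¹) := fun j => by
    have := Real.rpow_le_rpow (by positivity) (h j) (inv_nonneg.2 (Nat.cast_nonneg m))
    rwa [← Real.rpow_natCast, ← Real.rpow_mul (abs_nonneg _), mul_inv_cancel₀ hm',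
      Real.rpow_one] at this
  have hnorm : ‖ξ‖ ≤ ∑ j, |ξ j| := by
    rw [EuclideanSpace.norm_eq]
    refine Real.sqrt_le_iff.2 ⟨Finset.sum_nonneg fun _ _ => abs_nonneg _, ?_⟩
    simp only [Real.norm_eq_abs]
    exact Finset.sum_sq_le_sq_sum_of_nonneg fun _ _ => abs_nonneg _
  have hsum : ∑ j, |ξ j| ≤ n * L ^ ((m : ℝ)⁻¹) := by
    refine (Finset.sum_le_sum fun j _ => hj j).trans ?_
    simp
  linarith

/-- The coordinate bounds give `1 + |ξ| ≤ (1 + n) L^{1/m}`, which compares `L^{-s}` with `(1 +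
|ξ|)^{-ms}`. -/
theorem memLp_rpow_neg {q : ℝ≥0∞} (hq : q ≠ 0) {L : Euc n → ℝ} (hL : Continuous L)
    (hL1 : ∀ ξ, 1 ≤ L ξ) {m : ℕ} (hm : 0 < m) (hlow : ∀ ξ j, |ξ j| ^ m ≤ L ξ) {s : ℝ}
    (hs : 0 ≤ s) (hns : (n : ℝ) * (q⁻¹).toReal < m * s) : MemLp (fun ξ => L ξ ^ (-s)) q := by
  have hpos : ∀ ξ, 0 < L ξ := fun ξ => one_pos.trans_le (hL1 ξ)
  have hm' : (m : ℝ) ≠ 0 := by exact_mod_cast hm.ne'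
  refine (memLp_rpow_one_add_norm hq (by positivity) hns).of_le_mul (c := (1 + n : ℝ) ^ (m * s))
    (hL.rpow_const fun ξ => Or.inl (hpos ξ).ne').aestronglyMeasurable
    (Filter.Eventually.of_forall fun ξ => ?_)
  have hn : (0 : ℝ) < 1 + n := by positivity
  have hξ : 0 < 1 + ‖ξ‖ := by positivity
  rw [Real.norm_of_nonneg (Real.rpow_nonneg (hpos ξ).le _),
    Real.norm_of_nonneg (Real.rpow_nonneg hξ.le _), Real.rpow_neg hξ.le, Real.rpow_neg (hpos ξ).le,
    ← div_eq_mul_inv, le_div_iff₀ (by positivity), mul_comm, ← div_eq_mul_inv,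
    div_le_iff₀ (Real.rpow_pos_of_pos (hpos ξ) _)]
  calc (1 + ‖ξ‖) ^ (m * s) ≤ ((1 + n) * L ξ ^ ((m : ℝ)⁻¹)) ^ (m * s) :=
        Real.rpow_le_rpow hξ.le (one_add_norm_le hm (hL1 ξ) (hlow ξ)) (by positivity)
    _ = _ := by
        rw [Real.mul_rpow hn.le (Real.rpow_nonneg (hpos ξ).le _), ← Real.rpow_mul (hpos ξ).le,
          inv_mul_cancel_left₀ hm']

theorem add_rpow_le {a b r : ℝ} (ha : 0 ≤ a) (hb : 0 ≤ b) (hr : 0 ≤ r) :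
    (a + b) ^ r ≤ 2 ^ r * (a ^ r + b ^ r) := by
  have hmax : a + b ≤ 2 * max a b := by linarith [le_max_left a b, le_max_right a b]
  refine (Real.rpow_le_rpow (by positivity) hmax hr).trans ?_
  rw [Real.mul_rpow (by norm_num) (le_max_of_le_left ha)]
  gcongr
  rcases max_choice a b with h | h <;> rw [h] <;>
    linarith [Real.rpow_nonneg ha r, Real.rpow_nonneg hb r]

theorem isAlgebra_rpow {p q : ℝ≥0∞} [hpq : q.HolderConjugate p] {L : Euc n → ℝ}
    (hL : Continuous L) (hL1 : ∀ ξ, 1 ≤ L ξ) {m : ℕ} (hm : 0 < m)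
    (hlow : ∀ ξ j, |ξ j| ^ m ≤ L ξ) {δ C : ℝ} (hδ0 : 0 ≤ δ) (hδ : δ < 1) (hC : 0 ≤ C)
    (hmul : ∀ ξ η, L (ξ + η) ≤ C * (L ξ * L η ^ δ + L ξ ^ δ * L η)) {r : ℝ}
    (hr : (n : ℝ) * (q⁻¹).toReal / ((1 - δ) * m) < r) : IsAlgebra p (fun ξ => L ξ ^ r) := by
  have hpos : ∀ ξ, 0 < L ξ := fun ξ => one_pos.trans_le (hL1 ξ)
  have hq : q ≠ 0 := (ENNReal.HolderConjugate.pos q p).ne'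
  have hδ' : 0 < 1 - δ := sub_pos.2 hδ
  have hm' : (0 : ℝ) < m := by exact_mod_cast hm
  have hr0 : 0 < r := lt_of_le_of_lt (by positivity) hr
  rw [div_lt_iff₀ (by positivity)] at hr
  have hκ : MemLp (fun ξ => L ξ ^ (-((1 - δ) * r))) q :=
    memLp_rpow_neg hq hL hL1 hm hlow (by positivity) (by linarith)
  -- Here `(L^δ)^r = L^r L^{-(1-δ)r}`; the constants come from `C` and from `add_rpow_le`.
  refine isAlgebra_of_weight (q := q) (κ := fun ξ => (C ^ r * 2 ^ r) * L ξ ^ (-((1 - δ) * r)))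
    (hL.rpow_const fun ξ => Or.inl (hpos ξ).ne') (fun ξ => Real.rpow_pos_of_pos (hpos ξ) r)
    (fun ξ η => ?_) (hκ.const_mul _) ?_
  · have hξ := hpos ξ
    have hη := hpos η
    have hsplit : ∀ x : ℝ, 0 < x → (x ^ δ) ^ r = x ^ r * x ^ (-((1 - δ) * r)) := fun x hx => by
      rw [← Real.rpow_mul hx.le, ← Real.rpow_add hx]
      congr 1
      ring
    calc L (ξ + η) ^ r ≤ (C * (L ξ * L η ^ δ + L ξ ^ δ * L η)) ^ r :=
          Real.rpow_le_rpow (hpos _).le (hmul ξ η) hr0.le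
      _ = C ^ r * (L ξ * L η ^ δ + L ξ ^ δ * L η) ^ r := Real.mul_rpow hC (by positivity)
      _ ≤ C ^ r * (2 ^ r * ((L ξ * L η ^ δ) ^ r + (L ξ ^ δ * L η) ^ r)) := by
          gcongr
          exact add_rpow_le (by positivity) (by positivity) hr0.le
      _ = _ := by
          rw [Real.mul_rpow hξ.le (by positivity), Real.mul_rpow (by positivity) hη.le,
            hsplit _ hξ, hsplit _ hη]
          ring
  -- Since `L ≥ 1` and `δ ≥ 0`, `L^{-r}` is dominated by `L^{-(1-δ)r}`.
  · refine hκ.of_le ?_ (Filter.Eventually.of_forall fun ξ => ?_)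
    · exact ((hL.rpow_const fun ξ => Or.inl (hpos ξ).ne').inv₀
        fun ξ => (Real.rpow_pos_of_pos (hpos ξ) r).ne').aestronglyMeasurable
    · rw [← Real.rpow_neg (hpos ξ).le, Real.norm_of_nonneg (Real.rpow_nonneg (hpos ξ).le _),
        Real.norm_of_nonneg (Real.rpow_nonneg (hpos ξ).le _)]
      exact Real.rpow_le_rpow_of_exponent_le (hL1 ξ) (by nlinarith)

/-! ### Quasi-homogeneous weights -/

theorem continuous_quasiHomWeight (M : Fin n → ℕ) :
    Continuous (quasiHomWeight M : Euc n → ℝ) := by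
  unfold quasiHomWeight
  fun_prop

theorem one_le_quasiHomWeight (M : Fin n → ℕ) (ξ : Euc n) : 1 ≤ quasiHomWeight M ξ := by
  refine Real.one_le_sqrt.2 ?_
  have : 0 ≤ ∑ j, ξ j ^ (2 * M j) :=
    Finset.sum_nonneg fun j _ => (even_two_mul (M j)).pow_nonneg _
  linarith

theorem abs_pow_le_of_le {x L : ℝ} {m k : ℕ} (hmk : m ≤ k) (hx : |x| ^ k ≤ L) (hL : 1 ≤ L) :
    |x| ^ m ≤ L := by
  rcases le_total |x| 1 with h | h
  · exact (pow_le_one₀ (abs_nonneg x) h).trans hL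
  · exact (pow_le_pow_right₀ h hmk).trans hx

theorem abs_pow_le_quasiHomWeight (M : Fin n → ℕ) (ξ : Euc n) (j : Fin n) :
    |ξ j| ^ M j ≤ quasiHomWeight M ξ := by
  refine Real.le_sqrt_of_sq_le ?_
  have h := Finset.single_le_sum (f := fun j => ξ j ^ (2 * M j))
    (fun j _ => (even_two_mul (M j)).pow_nonneg _) (Finset.mem_univ j)
  rw [← pow_mul, mul_comm, (even_two_mul (M j)).pow_abs]
  simp only at h
  linarith

theorem add_pow_two_mul_le (x y : ℝ) {m k : ℕ} (hmk : m ≤ k) :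
    (x + y) ^ (2 * m) ≤ 4 ^ k * (x ^ (2 * m) + y ^ (2 * m)) := by
  have h1 : (x + y) ^ 2 ≤ 4 * max (x ^ 2) (y ^ 2) := by
    nlinarith [le_max_left (x ^ 2) (y ^ 2), le_max_right (x ^ 2) (y ^ 2), sq_nonneg (x - y)]
  have h2 : max (x ^ 2) (y ^ 2) ^ m ≤ (x ^ 2) ^ m + (y ^ 2) ^ m := by
    have hx : 0 ≤ (x ^ 2) ^ m := by positivity
    have hy : 0 ≤ (y ^ 2) ^ m := by positivity
    rcases max_choice (x ^ 2) (y ^ 2) with h | h <;> rw [h] <;> linarith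
  simp only [pow_mul]
  calc ((x + y) ^ 2) ^ m ≤ (4 * max (x ^ 2) (y ^ 2)) ^ m := pow_le_pow_left₀ (sq_nonneg _) h1 m
    _ = 4 ^ m * max (x ^ 2) (y ^ 2) ^ m := mul_pow _ _ _
    _ ≤ 4 ^ k * ((x ^ 2) ^ m + (y ^ 2) ^ m) := by
        gcongr
        norm_num

theorem quasiHomWeight_add_le (M : Fin n → ℕ) (ξ η : Euc n) :
    quasiHomWeight M (ξ + η) ≤ 2 ^ (∑ j, M j) * (quasiHomWeight M ξ + quasiHomWeight M η) := by
  have hξ := one_le_quasiHomWeight M ξ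
  have hη := one_le_quasiHomWeight M η
  have hsq : ∀ ζ : Euc n, quasiHomWeight M ζ ^ 2 = 1 + ∑ j, ζ j ^ (2 * M j) := fun ζ =>
    Real.sq_sqrt (add_nonneg zero_le_one
      (Finset.sum_nonneg fun j _ => (even_two_mul (M j)).pow_nonneg _))
  refine Real.sqrt_le_iff.2 ⟨by positivity, ?_⟩
  have h4 : ((2 : ℝ) ^ (∑ j, M j)) ^ 2 = 4 ^ (∑ j, M j) := by
    rw [← pow_mul, mul_comm, pow_mul]
    norm_num
  have h41 : (1 : ℝ) ≤ 4 ^ (∑ j, M j) := one_le_pow₀ (by norm_num)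
  calc 1 + ∑ j, (ξ + η) j ^ (2 * M j)
      ≤ 4 ^ (∑ j, M j) * (2 + ∑ j, (ξ j ^ (2 * M j) + η j ^ (2 * M j))) := by
        rw [mul_add, Finset.mul_sum]
        refine add_le_add (by linarith) (Finset.sum_le_sum fun j _ => ?_)
        -- The exponent `∑ M_j` dominates each `M_j`, so one constant serves all coordinates.
        exact add_pow_two_mul_le _ _ (Finset.single_le_sum (fun _ _ => Nat.zero_le _)
          (Finset.mem_univ j))
    _ = 4 ^ (∑ j, M j) * (quasiHomWeight M ξ ^ 2 + quasiHomWeight M η ^ 2) := by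
        rw [hsq, hsq, Finset.sum_add_distrib]
        ring
    _ ≤ _ := by
        rw [mul_pow, h4]
        gcongr
        nlinarith

theorem isAlgebra_quasiHomWeight {p q : ℝ≥0∞} [hpq : q.HolderConjugate p] {M : Fin n → ℕ}
    {m : ℕ} (hm : 0 < m) (hmM : ∀ j, m ≤ M j) {r : ℝ} (hr : (n : ℝ) * (q⁻¹).toReal / m < r) :
    IsAlgebra p (fun ξ : Euc n => quasiHomWeight M ξ ^ r) := by
  refine isAlgebra_rpow (q := q) (C := 2 ^ (∑ j, M j)) (continuous_quasiHomWeight M)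
    (one_le_quasiHomWeight M) hm (fun ξ j => ?_) le_rfl zero_lt_one (by positivity)
    (fun ξ η => ?_) (by simpa using hr)
  · exact abs_pow_le_of_le (hmM j) (abs_pow_le_quasiHomWeight M ξ j) (one_le_quasiHomWeight M ξ)
  · simpa using quasiHomWeight_add_le M ξ η

theorem homWeight_eq_quasiHomWeight : (homWeight : Euc n → ℝ) = quasiHomWeight fun _ => 1 := by
  ext ξ
  simp [homWeight, quasiHomWeight, EuclideanSpace.real_norm_sq_eq]

end FourierLebesgue

namespace FourierLebesgue

namespace CompletePolyhedron

/-! ### Multi-quasi-elliptic weights -/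

variable {n : ℕ} (P : CompletePolyhedron n)

theorem continuous_weight : Continuous P.weight := by
  unfold weight
  fun_prop

theorem prod_pow_two_mul (ξ : Euc n) (α : Fin n → ℕ) :
    ∏ j, ξ j ^ (2 * α j) = (∏ j, |ξ j| ^ α j) ^ 2 := by
  rw [← Finset.prod_pow]
  refine Finset.prod_congr rfl fun j _ => ?_
  rw [← pow_mul, mul_comm (α j), (even_two_mul (α j)).pow_abs]

theorem weight_sq (ξ : Euc n) :
    P.weight ξ ^ 2 = ∑ α ∈ P.vertices, (∏ j, |ξ j| ^ α j) ^ 2 := by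
  simp only [weight, prod_pow_two_mul]
  exact Real.sq_sqrt (Finset.sum_nonneg fun _ _ => sq_nonneg _)

variable {P} in
theorem prod_abs_pow_le_weight {α : Fin n → ℕ} (hα : α ∈ P.vertices) (ξ : Euc n) :
    ∏ j, |ξ j| ^ α j ≤ P.weight ξ := by
  refine le_of_sq_le_sq ?_ (Real.sqrt_nonneg _)
  rw [weight_sq]
  exact Finset.single_le_sum (f := fun α : Fin n → ℕ => (∏ j, |ξ j| ^ α j) ^ 2)
    (fun _ _ => sq_nonneg _) hα

theorem one_le_weight (ξ : Euc n) : 1 ≤ P.weight ξ := by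
  simpa using prod_abs_pow_le_weight P.zero_mem ξ

theorem mem_carrier_iff {x : Fin n → ℝ} :
    x ∈ P.carrier ↔ (∀ j, 0 ≤ x j) ∧ ∀ ν ∈ P.normals, ν ⬝ᵥ x ≤ 1 := by
  rw [carrier, P.convexHull_eq]
  rfl

variable {P} in
theorem latticePoint_mem_carrier {α : Fin n → ℕ} (hα : α ∈ P.vertices) :
    latticePoint α ∈ P.carrier :=
  subset_convexHull _ _ ⟨α, hα, rfl⟩

variable {P} in
-- The monomial is log-affine in its exponent, so the bound passes from the vertices to their convex
-- hull. Nonnegative exponents are kept in the convex set so that splitting powers stays valid when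
-- some `ξ_j = 0`.
theorem prod_abs_rpow_le_weight {x : Fin n → ℝ} (hx : x ∈ P.carrier) (ξ : Euc n) :
    ∏ j, |ξ j| ^ x j ≤ P.weight ξ := by
  have hL : 0 < P.weight ξ := one_pos.trans_le (P.one_le_weight ξ)
  have hconv : Convex ℝ {x : Fin n → ℝ | (∀ j, 0 ≤ x j) ∧ ∏ j, |ξ j| ^ x j ≤ P.weight ξ} := by
    rintro x ⟨hx0, hx⟩ y ⟨hy0, hy⟩ a b ha hb hab
    refine ⟨fun j => add_nonneg (mul_nonneg ha (hx0 j)) (mul_nonneg hb (hy0 j)), ?_⟩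
    calc ∏ j, |ξ j| ^ (a • x + b • y) j
        = (∏ j, |ξ j| ^ x j) ^ a * (∏ j, |ξ j| ^ y j) ^ b := by
          rw [← Real.finsetProd_rpow _ _ fun j _ => Real.rpow_nonneg (abs_nonneg _) _,
            ← Real.finsetProd_rpow _ _ fun j _ => Real.rpow_nonneg (abs_nonneg _) _,
            ← Finset.prod_mul_distrib]
          refine Finset.prod_congr rfl fun j _ => ?_
          rw [← Real.rpow_mul (abs_nonneg _), ← Real.rpow_mul (abs_nonneg _),
            ← Real.rpow_add_of_nonneg (abs_nonneg _) (mul_nonneg (hx0 j) ha)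
              (mul_nonneg (hy0 j) hb)]
          simp [mul_comm]
      _ ≤ P.weight ξ ^ a * P.weight ξ ^ b := by
          gcongr
      _ = P.weight ξ := by rw [← Real.rpow_add hL, hab, Real.rpow_one]
  refine (convexHull_min ?_ hconv hx).2
  rintro _ ⟨α, hα, rfl⟩
  refine ⟨fun j => Nat.cast_nonneg _, ?_⟩
  simpa [latticePoint] using prod_abs_pow_le_weight hα ξ

variable {P} in
theorem apply_le_of_mem_carrier {x : Fin n → ℝ} (hx : x ∈ P.carrier) (j : Fin n) :
    x j ≤ ((∑ α ∈ P.vertices, α j : ℕ) : ℝ) := by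
  have hconv : Convex ℝ {x : Fin n → ℝ | x j ≤ ((∑ α ∈ P.vertices, α j : ℕ) : ℝ)} :=
    convex_halfSpace_le (f := fun x : Fin n → ℝ => x j) ⟨fun _ _ => rfl, fun _ _ => rfl⟩ _
  refine convexHull_min ?_ hconv hx
  rintro _ ⟨α, hα, rfl⟩
  exact (Nat.cast_le (α := ℝ)).2
    (Finset.single_le_sum (f := fun α : Fin n → ℕ => α j) (fun _ _ => Nat.zero_le _) hα)

/-- Without normals the polyhedron would be the whole orthant, but a convex hull of finitely many
points is bounded. -/
theorem normals_nonempty [NeZero n] : P.normals.Nonempty := by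
  by_contra h
  rw [Finset.not_nonempty_iff_eq_empty] at h
  have hmem : (fun _ => ((∑ α ∈ P.vertices, α 0 : ℕ) : ℝ) + 1) ∈ P.carrier :=
    P.mem_carrier_iff.2 ⟨fun _ => by positivity, by simp [h]⟩
  have := apply_le_of_mem_carrier hmem 0
  linarith

/-- Otherwise every vertex, hence the polyhedron, satisfies `x_j ≤ K ∑_{i≠j} x_i`. This excludes `t
e_j` for `t > 0`, yet the half-space description contains it for small `t`. -/
theorem exists_vertex_on_axis (j : Fin n) :
    ∃ α ∈ P.vertices, α j ≠ 0 ∧ ∀ i, i ≠ j → α i = 0 := by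
  by_contra! hcon
  set K : ℝ := ((∑ α ∈ P.vertices, α j : ℕ) : ℝ) with hK
  have hconv : Convex ℝ {x : Fin n → ℝ | x j - K * ∑ i ∈ Finset.univ.erase j, x i ≤ 0} := by
    refine convex_halfSpace_le
      (f := fun x : Fin n → ℝ => x j - K * ∑ i ∈ Finset.univ.erase j, x i) ⟨?_, ?_⟩ _
    · intro x y
      simp only [Pi.add_apply, Finset.sum_add_distrib]
      ring
    · intro c x
      simp only [Pi.smul_apply, smul_eq_mul, ← Finset.mul_sum]
      ring
  have hsub : P.carrier ⊆ {x : Fin n → ℝ | x j - K * ∑ i ∈ Finset.univ.erase j, x i ≤ 0} := by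
    refine convexHull_min ?_ hconv
    rintro _ ⟨α, hα, rfl⟩
    have hs : 0 ≤ ∑ i ∈ Finset.univ.erase j, latticePoint α i :=
      Finset.sum_nonneg fun _ _ => Nat.cast_nonneg _
    have hle : latticePoint α j ≤ K := apply_le_of_mem_carrier (latticePoint_mem_carrier hα) j
    have hK0 : 0 ≤ K := Nat.cast_nonneg _
    simp only [Set.mem_ofPred_eq, tsub_le_iff_right, zero_add]
    rcases eq_or_ne (α j) 0 with h0 | h0
    · simp only [latticePoint, h0, Nat.cast_zero] at hs ⊢
      positivity
    · obtain ⟨i, hij, hi⟩ := hcon α hα h0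
      have h1 : (1 : ℝ) ≤ latticePoint α i := 
        Nat.one_le_cast.2 (Nat.one_le_iff_ne_zero.2 hi)
      have h2 := Finset.single_le_sum (f := latticePoint α) (fun _ _ => Nat.cast_nonneg _)
        (Finset.mem_erase.2 ⟨hij, Finset.mem_univ i⟩)
      exact hle.trans (le_mul_of_one_le_right hK0 (h1.trans h2))
  -- Small enough that `ν_j t ≤ 1` for every normal `ν` at once.
  set t : ℝ := (1 + ∑ ν ∈ P.normals, ν j)⁻¹ with ht
  have hsum : 0 ≤ ∑ ν ∈ P.normals, ν j := Finset.sum_nonneg fun ν hν => (P.normals_pos ν hν j).le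
  have ht0 : 0 < t := by positivity
  have hmem : Pi.single j t ∈ P.carrier := by
    refine P.mem_carrier_iff.2 ⟨fun i => ?_, fun ν hν => ?_⟩
    · rcases eq_or_ne i j with rfl | h
      · simpa using ht0.le
      · simp [h]
    · rw [dotProduct_single, ht, ← div_eq_mul_inv, div_le_one (by positivity)]
      have := Finset.single_le_sum (f := fun ν : Fin n → ℝ => ν j)
        (fun ν hν => (P.normals_pos ν hν j).le) hν
      linarith
  have h := hsub hmem
  have hz : ∑ i ∈ Finset.univ.erase j, (Pi.single j t : Fin n → ℝ) i = 0 :=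
    Finset.sum_eq_zero fun i hi => by simp [(Finset.mem_erase.1 hi).1]
  simp only [Set.mem_ofPred_eq, hz, Pi.single_eq_same] at h
  linarith

theorem minOrder_pos : 0 < P.minOrder := by
  have hne : {k | ∃ γ ∈ P.vertices, γ ≠ 0 ∧ k = ∑ j, γ j}.Nonempty := by
    by_contra h
    refine P.vertices_ne (Finset.eq_singleton_iff_unique_mem.2 ⟨P.zero_mem, fun γ hγ => ?_⟩)
    by_contra hγ0
    exact h ⟨_, γ, hγ, hγ0, rfl⟩
  obtain ⟨γ, -, hγ0, hk⟩ := Nat.sInf_mem hne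
  refine Nat.pos_of_ne_zero fun h => hγ0 (funext fun j => ?_)
  rw [minOrder, hk] at h
  exact (Finset.sum_eq_zero_iff.1 h) j (Finset.mem_univ j)

/-- The vertex on the `j`-th axis has order at least `μ₀`, and its monomial is a pure power of
`ξ_j`. -/
theorem abs_pow_minOrder_le_weight (ξ : Euc n) (j : Fin n) :
    |ξ j| ^ P.minOrder ≤ P.weight ξ := by
  obtain ⟨α, hα, hj, hi⟩ := P.exists_vertex_on_axis j
  have hsum : ∑ i, α i = α j :=
    Finset.sum_eq_single j (fun i _ h => hi i h) (by simp)
  have hprod : ∏ i, |ξ i| ^ α i = |ξ j| ^ α j :=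
    Finset.prod_eq_single j (fun i _ h => by simp [hi i h]) (by simp)
  refine abs_pow_le_of_le (k := α j) (Nat.sInf_le ⟨α, hα, ?_, hsum.symm⟩) ?_ (P.one_le_weight ξ)
  · rintro rfl
    exact hj rfl
  · rw [← hprod]
    exact prod_abs_pow_le_weight hα ξ

/-! ### The exponent `δ` and the weight at a sum -/

/-- The set whose maximum is `δ`. -/
def deltaSet : Set ℝ := {t | ∃ β : Fin n → ℕ, latticePoint β ∈ P.carrier ∧
  (∀ ν ∈ P.normals, ν ⬝ᵥ latticePoint β ≠ 1) ∧ ∃ ν ∈ P.normals, t = ν ⬝ᵥ latticePoint β}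

theorem finite_deltaSet : P.deltaSet.Finite := by
  have hfin : {β : Fin n → ℕ | latticePoint β ∈ P.carrier}.Finite :=
    (Set.finite_Iic (fun j => ∑ α ∈ P.vertices, α j)).subset fun β hβ j =>
      Nat.cast_le.1 (apply_le_of_mem_carrier hβ j)
  refine (Set.Finite.image2 (fun β ν => ν ⬝ᵥ latticePoint β) hfin P.normals.finite_toSet).subset ?_
  rintro t ⟨β, hβ, -, ν, hν, rfl⟩
  exact ⟨β, hβ, ν, hν, rfl⟩

theorem zero_mem_deltaSet [NeZero n] : 0 ∈ P.deltaSet := by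
  obtain ⟨ν, hν⟩ := P.normals_nonempty
  have h0 : latticePoint (0 : Fin n → ℕ) = 0 := funext fun j => Nat.cast_zero
  exact ⟨0, latticePoint_mem_carrier P.zero_mem, fun ν _ => by simp [h0], ν, hν, by simp [h0]⟩

theorem delta_nonneg [NeZero n] : 0 ≤ P.delta :=
  le_csSup P.finite_deltaSet.bddAbove P.zero_mem_deltaSet

/-- The supremum is over a finite set, hence attained, and an admissible `β` lies on no outer face.
-/
theorem delta_lt_one [NeZero n] : P.delta < 1 := by
  obtain ⟨β, hβ, hne, ν, hν, h⟩ := Set.Nonempty.csSup_mem ⟨0, P.zero_mem_deltaSet⟩ P.finite_deltaSet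
  change P.delta = _ at h
  rw [h]
  exact lt_of_le_of_ne ((P.mem_carrier_iff.1 hβ).2 ν hν) (hne ν hν)

variable {P} in
-- When `δ > 0`, the point `β/δ` still lies in the polyhedron; its monomial is at most the weight,
-- and raising to the power `δ` gives the claim.
theorem prod_abs_pow_le_weight_rpow_delta [NeZero n] {β : Fin n → ℕ}
    (hβ : latticePoint β ∈ P.carrier) (hne : ∀ ν ∈ P.normals, ν ⬝ᵥ latticePoint β ≠ 1)
    (ξ : Euc n) : ∏ j, |ξ j| ^ β j ≤ P.weight ξ ^ P.delta := by
  have hle : ∀ ν ∈ P.normals, ν ⬝ᵥ latticePoint β ≤ P.delta := fun ν hν =>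
    le_csSup P.finite_deltaSet.bddAbove ⟨β, hβ, hne, ν, hν, rfl⟩
  -- If `δ = 0`, division is impossible, but positivity of a normal forces `β = 0`.
  rcases P.delta_nonneg.eq_or_lt with h0 | h0
  · obtain ⟨ν, hν⟩ := P.normals_nonempty
    have hβ0 : ∀ j, β j = 0 := by
      have h1 : ∑ j, ν j * latticePoint β j = 0 :=
        le_antisymm ((hle ν hν).trans h0.ge)
          (Finset.sum_nonneg fun j _ => mul_nonneg (P.normals_pos ν hν j).le (Nat.cast_nonneg _))
      intro j
      have h2 := (Finset.sum_eq_zero_iff_of_nonneg fun j _ =>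
        mul_nonneg (P.normals_pos ν hν j).le (Nat.cast_nonneg _)).1 h1 j (Finset.mem_univ j)
      exact Nat.cast_eq_zero.1 ((mul_eq_zero.1 h2).resolve_left (P.normals_pos ν hν j).ne')
    simp [hβ0, ← h0]
  · have hmem : P.delta⁻¹ • latticePoint β ∈ P.carrier := by
      refine P.mem_carrier_iff.2 ⟨fun j => ?_, fun ν hν => ?_⟩
      · exact mul_nonneg (inv_nonneg.2 h0.le) (Nat.cast_nonneg _)
      · rw [dotProduct_smul, smul_eq_mul, inv_mul_le_one₀ h0]
        exact hle ν hν
    have h := Real.rpow_le_rpow (Finset.prod_nonneg fun j _ => Real.rpow_nonneg (abs_nonneg _) _)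
      (prod_abs_rpow_le_weight hmem ξ) h0.le
    rw [← Real.finsetProd_rpow _ _ fun j _ => Real.rpow_nonneg (abs_nonneg _) _] at h
    refine le_of_eq_of_le (Finset.prod_congr rfl fun j _ => ?_) h
    rw [← Real.rpow_mul (abs_nonneg _), Pi.smul_apply, smul_eq_mul, mul_right_comm,
      inv_mul_cancel₀ h0.ne', one_mul, latticePoint, Real.rpow_natCast]

theorem dotProduct_latticePoint_pos {ν : Fin n → ℝ} (hν : ∀ j, 0 < ν j) {β : Fin n → ℕ}
    (hβ : β ≠ 0) : 0 < ν ⬝ᵥ latticePoint β := by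
  obtain ⟨j, hj⟩ := Function.ne_iff.1 hβ
  refine Finset.sum_pos' (fun i _ => mul_nonneg (hν i).le (Nat.cast_nonneg _))
    ⟨j, Finset.mem_univ j, 
    mul_pos (hν j) (Nat.cast_pos.2 (Nat.pos_of_ne_zero hj))⟩

variable {P} in
theorem prod_abs_pow_mul_prod_abs_pow_le [NeZero n] {β γ : Fin n → ℕ}
    (h : β + γ ∈ P.vertices) (ξ η : Euc n) :
    (∏ j, |ξ j| ^ β j) * ∏ j, |η j| ^ γ j ≤
      P.weight ξ * P.weight η ^ P.delta + P.weight ξ ^ P.delta * P.weight η := by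
  have hξ := P.one_le_weight ξ
  have hη := P.one_le_weight η
  have hξd : 1 ≤ P.weight ξ ^ P.delta := Real.one_le_rpow hξ P.delta_nonneg
  have hηd : 1 ≤ P.weight η ^ P.delta := Real.one_le_rpow hη P.delta_nonneg
  rcases eq_or_ne β 0 with rfl | hβ
  · rw [zero_add] at h
    have := prod_abs_pow_le_weight h η
    simp only [Pi.zero_apply, pow_zero, Finset.prod_const_one, one_mul]
    nlinarith
  rcases eq_or_ne γ 0 with rfl | hγ
  · rw [add_zero] at h
    have := prod_abs_pow_le_weight h ξ
    simp only [Pi.zero_apply, pow_zero, Finset.prod_const_one, mul_one]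
    nlinarith
  -- As `β` and `γ` are both nonzero, each takes a positive share of `ν · (β + γ) ≤ 1`, leaving the
  -- other strictly below `1`.
  have hsum : ∀ ν ∈ P.normals, ν ⬝ᵥ latticePoint β + ν ⬝ᵥ latticePoint γ ≤ 1 := by
    intro ν hν
    have h1 := (P.mem_carrier_iff.1 (latticePoint_mem_carrier h)).2 ν hν
    have h2 : latticePoint (β + γ) = latticePoint β + latticePoint γ :=
      funext fun j => Nat.cast_add _ _
    rwa [h2, dotProduct_add] at h1
  have hβν : ∀ ν ∈ P.normals, ν ⬝ᵥ latticePoint β < 1 := fun ν hν => by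
    linarith [hsum ν hν, dotProduct_latticePoint_pos (P.normals_pos ν hν) hγ]
  have hγν : ∀ ν ∈ P.normals, ν ⬝ᵥ latticePoint γ < 1 := fun ν hν => by
    linarith [hsum ν hν, dotProduct_latticePoint_pos (P.normals_pos ν hν) hβ]
  have h1 := prod_abs_pow_le_weight_rpow_delta (P.mem_carrier_iff.2
    ⟨fun j => Nat.cast_nonneg _, fun ν hν => (hβν ν hν).le⟩) (fun ν hν => (hβν ν hν).ne) ξ
  have h2 := prod_abs_pow_le_weight_rpow_delta (P.mem_carrier_iff.2
    ⟨fun j => Nat.cast_nonneg _, fun ν hν => (hγν ν hν).le⟩) (fun ν hν => (hγν ν hν).ne) η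
  have h3 : P.weight ξ ^ P.delta ≤ P.weight ξ := by
    simpa using Real.rpow_le_rpow_of_exponent_le hξ P.delta_lt_one.le
  calc _ ≤ P.weight ξ ^ P.delta * P.weight η ^ P.delta :=
        mul_le_mul h1 h2 (Finset.prod_nonneg fun _ _ => by positivity) (by positivity)
    _ ≤ P.weight ξ * P.weight η ^ P.delta := by gcongr
    _ ≤ _ := le_add_of_nonneg_right (by positivity)

/-- In each coordinate `|ξ_j + η_j|` is at most twice the larger modulus, so the whole exponent
`α_j` goes to that variable and no binomial expansion is needed. -/
theorem exists_prod_abs_add_pow_le (α : Fin n → ℕ) (ξ η : Euc n) :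
    ∃ β γ, β + γ = α ∧ ∏ j, |(ξ + η) j| ^ α j ≤
      2 ^ (∑ j, α j) * ((∏ j, |ξ j| ^ β j) * ∏ j, |η j| ^ γ j) := by
  refine ⟨fun j => if |η j| ≤ |ξ j| then α j else 0, fun j => if |η j| ≤ |ξ j| then 0 else α j,
    funext fun j => ?_, ?_⟩
  · simp only [Pi.add_apply]
    split_ifs <;> simp
  · rw [← Finset.prod_mul_distrib, ← Finset.prod_pow_eq_pow_sum, ← Finset.prod_mul_distrib]
    refine Finset.prod_le_prod (fun _ _ => by positivity) fun j _ => ?_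
    have h := abs_add_le (ξ j) (η j)
    simp only [PiLp.add_apply]
    split_ifs with hj
    · rw [pow_zero, mul_one, ← mul_pow]
      exact pow_le_pow_left₀ (abs_nonneg _) (by linarith) _
    · rw [pow_zero, one_mul, ← mul_pow]
      exact pow_le_pow_left₀ (abs_nonneg _) (by linarith) _

theorem weight_add_le [NeZero n] (ξ η : Euc n) :
    P.weight (ξ + η) ≤ Real.sqrt (∑ α ∈ P.vertices, ((2 : ℝ) ^ (∑ j, α j)) ^ 2) *
      (P.weight ξ * P.weight η ^ P.delta + P.weight ξ ^ P.delta * P.weight η) := by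
  have hξ := one_pos.trans_le (P.one_le_weight ξ)
  have hη := one_pos.trans_le (P.one_le_weight η)
  refine le_of_sq_le_sq ?_ (by positivity)
  rw [weight_sq, mul_pow, Real.sq_sqrt (Finset.sum_nonneg fun _ _ => sq_nonneg _), Finset.sum_mul]
  refine Finset.sum_le_sum fun α hα => ?_
  obtain ⟨β, γ, rfl, h⟩ := exists_prod_abs_add_pow_le α ξ η
  rw [← mul_pow]
  refine pow_le_pow_left₀ (Finset.prod_nonneg fun _ _ => by positivity) (h.trans ?_) 2
  gcongr
  exact prod_abs_pow_mul_prod_abs_pow_le hα ξ η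

theorem isAlgebra_weight [NeZero n] {p q : ℝ≥0∞} [hpq : q.HolderConjugate p] {r : ℝ}
    (hr : (n : ℝ) * (q⁻¹).toReal / ((1 - P.delta) * (P.minOrder : ℝ)) < r) :
    IsAlgebra p (fun ξ : Euc n => P.weight ξ ^ r) :=
  isAlgebra_rpow (q := q) P.continuous_weight P.one_le_weight P.minOrder_pos
    P.abs_pow_minOrder_le_weight P.delta_nonneg P.delta_lt_one (Real.sqrt_nonneg _)
    P.weight_add_le hr

end CompletePolyhedron

end FourierLebesgue

/-! ### The three families of weights -/

theorem corollary3p4 (n : ℕ) (hn : 0 < n) (p q : ℝ≥0∞) (hpq : p⁻¹ + q⁻¹ = 1) (r : ℝ) :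
    ((n : ℝ) * (q⁻¹).toReal < r →
      FourierLebesgue.IsAlgebra p (fun ξ : FourierLebesgue.Euc n =>
        FourierLebesgue.homWeight ξ ^ r) ∧
      ∀ Ω : Opens (FourierLebesgue.Euc n), FourierLebesgue.IsLocAlgebra p
        (fun ξ => FourierLebesgue.homWeight ξ ^ r) Ω) ∧
    (∀ M : Fin n → ℕ, (∀ j, 0 < M j) →
      (n : ℝ) * (q⁻¹).toReal / ((⨅ j, M j : ℕ) : ℝ) < r →
      FourierLebesgue.IsAlgebra p (fun ξ : FourierLebesgue.Euc n =>
        FourierLebesgue.quasiHomWeight M ξ ^ r) ∧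
      ∀ Ω : Opens (FourierLebesgue.Euc n), FourierLebesgue.IsLocAlgebra p
        (fun ξ => FourierLebesgue.quasiHomWeight M ξ ^ r) Ω) ∧
    (∀ P : FourierLebesgue.CompletePolyhedron n,
      (n : ℝ) * (q⁻¹).toReal / ((1 - P.delta) * (P.minOrder : ℝ)) < r →
      FourierLebesgue.IsAlgebra p (fun ξ : FourierLebesgue.Euc n => P.weight ξ ^ r) ∧
      ∀ Ω : Opens (FourierLebesgue.Euc n), FourierLebesgue.IsLocAlgebra p
        (fun ξ => P.weight ξ ^ r) Ω) := by
  have hqp : q.HolderConjugate p := ENNReal.holderConjugate_iff.2 (by rwa [add_comm])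
  have : NeZero n := ⟨hn.ne'⟩
  refine ⟨fun hr => ?_, fun M hM hr => ?_, fun P hr => ?_⟩
  · have h : FourierLebesgue.IsAlgebra p (fun ξ : FourierLebesgue.Euc n =>
        FourierLebesgue.homWeight ξ ^ r) := by
      rw [FourierLebesgue.homWeight_eq_quasiHomWeight]
      exact FourierLebesgue.isAlgebra_quasiHomWeight (q := q) one_pos (fun _ => le_rfl)
        (by simpa using hr)
    exact ⟨h, h.isLocAlgebra⟩
  · have h := FourierLebesgue.isAlgebra_quasiHomWeight (p := p) (q := q) (M := M)
      -- The infimum is attained because `Fin n` is nonempty, and is therefore positive.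
      (m := ⨅ j, M j) (by obtain ⟨j, hj⟩ := ciInf_mem M; exact hj ▸ hM j)
      (fun j => ciInf_le (OrderBot.bddBelow _) j) hr
    exact ⟨h, h.isLocAlgebra⟩
  · have h := P.isAlgebra_weight (p := p) (q := q) hr
    exact ⟨h, h.isLocAlgebra⟩
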